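/- Let $\mathbb T^n=(\mathbb R/2\pi\mathbb Z)^n$, and let $\mathrm{SVect}(\mathbb T^d)$ be the space of smooth divergence-free vector fields on $\mathbb T^d$ with its $C^\infty$ topology. Assume that $d=3$ or that $d\ge 2$ is even. Then for every $N\ge 1$ and every $\nu\in\mathbb R^N\setminus\{0\}$ there is a smooth embedding $U:\mathbb T^N\to \mathrm{SVect}(\mathbb T^d)$ (that is, a smooth map which has injective differential at every point and is a homeomorphism onto its image) such that: 1. $U$ is non-symmetric: for every $\theta\in\mathbb T^N$ and every $a\in\mathbb R^d\setminus\{0\}$, the field $U(\theta)$ is not invariant under the one-parameter group of translations $x\mapsto x+sa$, $s\in\mathbb R$. 2. For every $\theta\in\mathbb T^N$, the solution of the incompressible Euler equations $$\partial_t u+u\cdot\nabla u+\nabla p=0,\qquad \operatorname{div}u=0\qquad\text{on }\mathbb T^d$$ with initial datum $U(\theta)$ is $u(t,\cdot)=U(\theta+\nu t)$. That is, $t\mapsto U(\theta+\nu t)$ is, with a suitable smooth pressure on $\mathbb T^d$, a smooth solution for all $t\in\mathbb R$, and any smooth solution (with smooth pressure on $\mathbb T^d$) with the same initial datum on a time interval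 containing $0$ coincides with it on that interval. -/

import Mathlib

open Filter Topology
open scoped ContDiff

noncomputable section

namespace EulerTorus

/-- The space `ℝⁿ` with its Euclidean structure. -/
abbrev Space (n : ℕ) : Type := EuclideanSpace ℝ (Fin n)

/-- The flat torus `𝕋ⁿ = (ℝ / 2πℤ)ⁿ`. -/
abbrev Torus (n : ℕ) : Type := Fin n → AddCircle (2 * Real.pi)

/-- The covering projection `ℝⁿ → 𝕋ⁿ`. -/
def proj {n : ℕ} (x : Space n) : Torus n := fun i => ((x i : ℝ) : AddCircle (2 * Real.pi))

/-- The divergence of a vector field on `ℝᵈ`. -/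
def divergence {d : ℕ} (u : Space d → Space d) (x : Space d) : ℝ :=
  ∑ i, (fderiv ℝ u x (EuclideanSpace.single i 1)) i

/-- The smooth divergence-free vector fields on `𝕋ᵈ`, as a linear subspace of all vector fields
(smoothness and divergence are read off from the `2πℤᵈ`-periodic lift to `ℝᵈ`). -/
def solenoidal (d : ℕ) : Submodule ℝ (Torus d → Space d) where
  carrier := {u | ContDiff ℝ ∞ (fun x => u (proj x)) ∧
    ∀ x, divergence (fun x => u (proj x)) x = 0}
  add_mem' := by
    rintro u v ⟨hu, hu'⟩ ⟨hv, hv'⟩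
    refine ⟨hu.add hv, fun x => ?_⟩
    have h1 := (hu.differentiable (by simp)) x
    have h2 := (hv.differentiable (by simp)) x
    have h : fderiv ℝ (fun x => (u + v) (proj x)) x =
        fderiv ℝ (fun x => u (proj x)) x + fderiv ℝ (fun x => v (proj x)) x :=
      fderiv_add h1 h2
    have e1 := hu' x
    have e2 := hv' x
    simp only [divergence] at e1 e2 ⊢
    rw [h]
    simp [Finset.sum_add_distrib, e1, e2]
  zero_mem' := by
    refine ⟨contDiff_const, fun x => ?_⟩
    simp [divergence]
  smul_mem' := by
    rintro c u ⟨hu, hu'⟩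
    refine ⟨contDiff_const.smul hu, fun x => ?_⟩
    have h1 := (hu.differentiable (by simp)) x
    have h : fderiv ℝ (fun x => (c • u) (proj x)) x = c • fderiv ℝ (fun x => u (proj x)) x :=
      fderiv_const_smul h1 c
    have e1 := hu' x
    simp only [divergence] at e1 ⊢
    rw [h]
    simp [← Finset.mul_sum, e1]

/-- The space `SVect(𝕋ᵈ)` of smooth divergence-free vector fields on `𝕋ᵈ`. It is a type of its own
(not reducible to a subtype of a function space) because it carries the `C^∞` topology defined
below, not the topology of pointwise convergence. -/
def SVect (d : ℕ) : Type := ↥(solenoidal d)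

instance (d : ℕ) : AddCommGroup (SVect d) := inferInstanceAs (AddCommGroup ↥(solenoidal d))

instance (d : ℕ) : Module ℝ (SVect d) := inferInstanceAs (Module ℝ ↥(solenoidal d))

/-- The underlying vector field on `𝕋ᵈ`. -/
def SVect.toFun {d : ℕ} (u : SVect d) : Torus d → Space d := Subtype.val u

instance (d : ℕ) : CoeFun (SVect d) (fun _ => Torus d → Space d) := ⟨SVect.toFun⟩

/-- The `2πℤᵈ`-periodic lift to `ℝᵈ` of a field on `𝕋ᵈ`. -/
def SVect.lift {d : ℕ} (u : SVect d) : Space d → Space d := fun x => u (proj x)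

/-- The `C^∞` (Fréchet) topology: uniform convergence of the derivatives of every order. -/
instance (d : ℕ) : TopologicalSpace (SVect d) :=
  TopologicalSpace.induced
    (fun (u : SVect d) (n : ℕ) => UniformFun.ofFun (iteratedFDeriv ℝ n u.lift)) inferInstance

section Smooth

/-- `w` is the directional derivative at `x` in the direction `h` of a map `f` from `ℝᴺ` to a
topological vector space. -/
def HasDirDeriv {N : ℕ} {F : Type} [AddCommGroup F] [Module ℝ F] [TopologicalSpace F]
    (f : Space N → F) (x h : Space N) (w : F) : Prop :=
  Tendsto (fun s : ℝ => s⁻¹ • (f (x + s • h) - f x)) (𝓝[≠] 0) (𝓝 w)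

/-- `f : ℝᴺ → F` is of class `C^k`, where `F` is a topological vector space: `f` is continuous and
all its iterated partial derivatives of order at most `k` exist and are continuous. -/
def IsCk {N : ℕ} {F : Type} [AddCommGroup F] [Module ℝ F] [TopologicalSpace F] :
    ℕ → (Space N → F) → Prop
  | 0, f => Continuous f
  | k + 1, f => Continuous f ∧ ∃ D : Fin N → Space N → F,
      (∀ i x, HasDirDeriv f x (EuclideanSpace.single i 1) (D i x)) ∧ ∀ i, IsCk k (D i)

/-- `U : 𝕋ᴺ → F` is a smooth embedding: it is smooth, its differential is injective at every
point, and it is a homeomorphism onto its image. -/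
structure IsSmoothEmbedding {N : ℕ} {F : Type} [AddCommGroup F] [Module ℝ F]
    [TopologicalSpace F] (U : Torus N → F) : Prop where
  smooth : ∀ k : ℕ, IsCk k (fun x : Space N => U (proj x))
  immersion : ∀ x h : Space N, h ≠ 0 →
    ∃ w : F, w ≠ 0 ∧ HasDirDeriv (fun x : Space N => U (proj x)) x h w
  isEmbedding : IsEmbedding U

end Smooth

/-- `v` is a smooth solution, on the time interval `I`, of the incompressible Euler equations
`∂ₜv + v·∇v + ∇p = 0`, `div v = 0` on `𝕋ᵈ`, for some smooth pressure `p` on `𝕋ᵈ`. The time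
derivative is one-sided at an endpoint of `I`. -/
def IsEulerSolutionOn {d : ℕ} (I : Set ℝ) (v : ℝ → SVect d) : Prop :=
  ContDiffOn ℝ ∞ (fun z : ℝ × Space d => (v z.1).lift z.2) (I ×ˢ Set.univ) ∧
  ∃ p : ℝ → Torus d → ℝ,
    ContDiffOn ℝ ∞ (fun z : ℝ × Space d => p z.1 (proj z.2)) (I ×ˢ Set.univ) ∧
    ∀ t ∈ I, ∀ x : Space d,
      derivWithin (fun s => (v s).lift x) I t
        + fderiv ℝ (v t).lift x ((v t).lift x)
        + gradient (fun y => p t (proj y)) x = 0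

/-- `v` is the solution of the Euler equations with initial datum `u₀`: it is a smooth solution
for all times `t ∈ ℝ`, it equals `u₀` at `t = 0`, and every smooth solution with the same initial
datum, on any interval around or starting or ending at `0`, agrees with it there. -/
structure IsTheEulerSolution {d : ℕ} (u₀ : SVect d) (v : ℝ → SVect d) : Prop where
  initial : v 0 = u₀
  isSolution : IsEulerSolutionOn Set.univ v
  unique : ∀ (I : Set ℝ), I.OrdConnected → 0 ∈ I → ∀ w : ℝ → SVect d,
    IsEulerSolutionOn I w → w 0 = u₀ → ∀ t ∈ I, w t = v t

/-- The field `u` on `𝕋ᵈ` is invariant under the one-parameter group of translations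
`x ↦ x + s a`, `s ∈ ℝ`. -/
def IsInvariantUnderTranslations {d : ℕ} (u : SVect d) (a : Space d) : Prop :=
  ∀ (s : ℝ) (x : Torus d), u (x + proj (s • a)) = u x

/-- No `U θ` is invariant under a (nontrivial) one-parameter group of translations. -/
def IsNonSymmetric {N d : ℕ} (U : Torus N → SVect d) : Prop :=
  ∀ (θ : Torus N) (a : Space d), a ≠ 0 → ¬ IsInvariantUnderTranslations (U θ) a

end EulerTorus

end

noncomputable section

namespace EulerTorus

/-! The solutions are shear flows that carry vortices. Take a shear `f(x₁) e₀` and disjoint strips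
in the coordinate `x₁` on each of which `f` is constant. In each strip place a circular flow in a
plane of coordinates `(k, 1)`, constant in the other coordinates, whose angular velocity vanishes
beyond the radius `ε`, so that it stays inside its strip. Alone, such a flow is a steady Euler
solution: a radial pressure balances the centripetal acceleration (`euler_circularFlow`). Where it
lives, the shear is a constant velocity, and vortices of different strips do not meet; hence the sum
evolves by rigid transport of each vortex along `e₀` with the speed of its strip
(`fderiv_shear_add_vortices`). If the `j`-th moving vortex lies in the plane `(0, 1)` at position `θ
j`, in a strip of speed `ν j`, the configuration follows `θ + ν t`.

Motionless vortices, one in each plane `(k, 1)` with `k ≠ 1`, sit in further strips of speed `0` and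
break all translation symmetries. The shear has no component along `e₁`, so this component shows the
vortices alone.

The family is a fixed field plus translates of fixed fields, and its derivatives have the same form;
smoothness reduces to that of translation in the `C^∞` topology (`tendsto_slope_translate`).
Injectivity comes from the strict decrease of the angular velocity, and compactness of the torus
then makes the map an embedding. Uniqueness of the Euler solution is the `L²` energy estimate for
the difference of two solutions (`euler_unique`). -/

instance : Fact (0 < 2 * Real.pi) := ⟨Real.two_pi_pos⟩

/-! ### Periodic lifts and the `C^∞` topology. -/

variable {d : ℕ}

theorem proj_add (x y : Space d) : proj (x + y) = proj x + proj y := by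
  ext i; simp [proj]

theorem proj_smul_single (i : Fin d) (s : ℝ) :
    proj (s • EuclideanSpace.single i (1 : ℝ)) = Pi.single i (s : AddCircle (2 * Real.pi)) := by
  ext j
  by_cases h : j = i
  · subst h; simp [proj]
  · simp [proj, h]

theorem isOpenQuotientMap_proj : IsOpenQuotientMap (proj : Space d → Torus d) := by
  have h : IsOpenQuotientMap (Pi.map fun (_ : Fin d) (x : ℝ) => (x : AddCircle (2 * Real.pi))) :=
    IsOpenQuotientMap.piMap fun _ => QuotientAddGroup.isOpenQuotientMap_mk
  exact h.comp (EuclideanSpace.equiv (Fin d) ℝ).toHomeomorph.isOpenQuotientMap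

theorem exists_proj_eq (X : Torus d) :
    ∃ x : Space d, proj x = X ∧ ∀ i, x i ∈ Set.Icc 0 (2 * Real.pi) := by
  have h : ∀ i, ∃ y : ℝ, y ∈ Set.Icc 0 (2 * Real.pi) ∧ (y : AddCircle (2 * Real.pi)) = X i := by
    intro i
    have := AddCircle.coe_image_Icc_eq (2 * Real.pi) (0 : ℝ)
    have hX : X i ∈ ((↑) : ℝ → AddCircle (2 * Real.pi)) '' Set.Icc 0 (0 + 2 * Real.pi) := by
      rw [this]; trivial
    simpa using hX
  choose y hy hy' using h
  exact ⟨WithLp.toLp 2 y, by ext i; simp [proj, hy'], by simpa using hy⟩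

/-- A function on `ℝᵈ` which is `2πℤᵈ`-periodic. -/
abbrev IsPeriodic {E : Type*} (g : Space d → E) : Prop :=
  Function.FactorsThrough g (proj : Space d → Torus d)

/-- A representative in `ℝᵈ` of a point of the torus. -/
def rep (X : Torus d) : Space d := (exists_proj_eq X).choose

@[simp] theorem proj_rep (X : Torus d) : proj (rep X) = X := (exists_proj_eq X).choose_spec.1

theorem IsPeriodic.rep_proj {E : Type*} {g : Space d → E} (hg : IsPeriodic g) (x : Space d) :
    g (rep (proj x)) = g x := hg (proj_rep _)

/-- The function descends to the compact torus, and the projection is a continuous homomorphism,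
hence uniformly continuous. This supplies all the uniformity in `x` that the `C^∞` topology demands.
-/
theorem IsPeriodic.uniformContinuous {E : Type*} [UniformSpace E] {g : Space d → E}
    (hg : IsPeriodic g) (hc : Continuous g) : UniformContinuous g := by
  have h1 : Continuous fun X : Torus d => g (rep X) := by
    rw [isOpenQuotientMap_proj.isQuotientMap.continuous_iff]
    exact hc.congr fun x => (hg.rep_proj x).symm
  have h2 := CompactSpace.uniformContinuous_of_continuous h1
  have h3 : UniformContinuous (proj : Space d → Torus d) :=
    uniformContinuous_addMonoidHom_of_continuous (f := AddMonoidHom.mk' proj proj_add)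
      isOpenQuotientMap_proj.continuous
  have h4 : (fun X : Torus d => g (rep X)) ∘ proj = g := funext hg.rep_proj
  exact h4 ▸ h2.comp h3

theorem IsPeriodic.fderiv {E : Type*} [NormedAddCommGroup E] [NormedSpace ℝ E] {g : Space d → E}
    (hg : IsPeriodic g) : IsPeriodic (fderiv ℝ g) := by
  intro x y hxy
  -- Points with the same projection differ by a period of `g`.
  have : (fun z => g (z + (y - x))) = g := by
    ext z
    apply hg
    have h : proj y = proj (y - x) + proj x := by rw [← proj_add]; simp
    rw [hxy] at h
    rw [proj_add, right_eq_add.1 h, add_zero]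
  have h2 := fderiv_comp_add_right (𝕜 := ℝ) (f := g) (x := x) (y - x)
  rw [this] at h2
  simpa using h2

namespace SVect

theorem contDiff_lift (u : SVect d) : ContDiff ℝ ∞ u.lift := u.2.1

theorem divergence_lift (u : SVect d) (x : Space d) : divergence u.lift x = 0 := u.2.2 x

theorem isPeriodic_lift (u : SVect d) : IsPeriodic u.lift := fun x y h => by
  simp only [lift, h]

theorem lift_injective : Function.Injective (lift : SVect d → Space d → Space d) := by
  intro u v h
  apply Subtype.ext
  ext1 X
  have := congrFun h (rep X)
  simp only [lift, proj_rep] at this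
  exact this

theorem lift_add (u v : SVect d) : (u + v).lift = u.lift + v.lift := rfl
theorem lift_sub (u v : SVect d) : (u - v).lift = u.lift - v.lift := rfl
theorem lift_smul (c : ℝ) (u : SVect d) : (c • u).lift = c • u.lift := rfl
theorem lift_zero : (0 : SVect d).lift = 0 := rfl

theorem lift_sum {ι : Type*} (s : Finset ι) (u : ι → SVect d) :
    (∑ i ∈ s, u i).lift = ∑ i ∈ s, (u i).lift :=
  map_sum (AddMonoidHom.mk' (lift : SVect d → Space d → Space d) lift_add) u s

/-- The element of `SVect` with a given smooth periodic solenoidal lift. -/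
def ofLift (g : Space d → Space d) (hp : IsPeriodic g) (hs : ContDiff ℝ ∞ g)
    (hd : ∀ x, divergence g x = 0) : SVect d :=
  ⟨fun X => g (rep X), by
    have : (fun x => g (rep (proj x))) = g := funext hp.rep_proj
    change ContDiff ℝ ∞ (fun x => g (rep (proj x))) ∧
      ∀ x, divergence (fun x => g (rep (proj x))) x = 0
    rw [this]
    exact ⟨hs, hd⟩⟩

theorem lift_ofLift (g : Space d → Space d) (hp : IsPeriodic g) (hs : ContDiff ℝ ∞ g)
    (hd : ∀ x, divergence g x = 0) : (ofLift g hp hs hd).lift = g := funext hp.rep_proj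

theorem tendsto_nhds_iff {ι : Type*} {l : Filter ι} {g : ι → SVect d} {u : SVect d} :
    Tendsto g l (𝓝 u) ↔ ∀ n, TendstoUniformly (fun a => iteratedFDeriv ℝ n (g a).lift)
      (iteratedFDeriv ℝ n u.lift) l := by
  rw [nhds_induced, tendsto_comap_iff, tendsto_pi_nhds]
  exact forall_congr' fun n => UniformFun.tendsto_iff_tendstoUniformly

theorem iteratedFDeriv_lift_add (u v : SVect d) (n : ℕ) :
    iteratedFDeriv ℝ n (u + v).lift = iteratedFDeriv ℝ n u.lift + iteratedFDeriv ℝ n v.lift :=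
  iteratedFDeriv_add (u.contDiff_lift.of_le (by exact_mod_cast le_top))
    (v.contDiff_lift.of_le (by exact_mod_cast le_top))

instance : ContinuousAdd (SVect d) := by
  refine ⟨continuous_iff_continuousAt.2 fun p => ?_⟩
  rw [ContinuousAt, tendsto_nhds_iff]
  intro n
  simp only [iteratedFDeriv_lift_add]
  exact (tendsto_nhds_iff.1 (continuous_fst.tendsto p) n).add
    (tendsto_nhds_iff.1 (continuous_snd.tendsto p) n)

/-- Needed to turn a continuous injection of the compact torus into an embedding. -/
instance : T2Space (SVect d) := by
  refine T2Space.of_injective_continuous (f := fun (u : SVect d) (n : ℕ) =>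
    UniformFun.ofFun (iteratedFDeriv ℝ n u.lift)) ?_ continuous_induced_dom
  intro u v h
  apply lift_injective
  ext1 x
  have h0 := congrFun (congrArg UniformFun.toFun (congrFun h 0)) x
  have h1 := congrArg (fun A => A ![]) h0
  simpa using h1

/-- The translate `x ↦ u (x + b)`. -/
def translate (b : Torus d) (u : SVect d) : SVect d :=
  ⟨fun X => u (X + b), by
    obtain ⟨c, rfl, -⟩ := exists_proj_eq b
    have : (fun x => u (proj x + proj c)) = fun x => u.lift (x + c) := by
      ext1 x; simp [lift, proj_add]
    change ContDiff ℝ ∞ (fun x => u (proj x + proj c)) ∧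
      ∀ x, divergence (fun x => u (proj x + proj c)) x = 0
    rw [this]
    refine ⟨u.contDiff_lift.comp (contDiff_id.add contDiff_const), fun x => ?_⟩
    rw [divergence, fderiv_comp_add_right]
    exact u.divergence_lift _⟩

theorem lift_translate_proj (b : Space d) (u : SVect d) :
    (translate (proj b) u).lift = fun x => u.lift (x + b) := by
  ext1 x
  simp only [lift, proj_add]
  rfl

end SVect

/-! ### Commuting derivatives. -/

section Derivatives

variable {E F : Type*} [NormedAddCommGroup E] [NormedSpace ℝ E] [NormedAddCommGroup F]
  [NormedSpace ℝ F]

theorem fderiv_fderiv_apply_comm {f : E → F} (hf : ContDiff ℝ ∞ f) (x v w : E) :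
    fderiv ℝ (fun y => fderiv ℝ f y v) x w = fderiv ℝ (fun y => fderiv ℝ f y w) x v := by
  have h1 : DifferentiableAt ℝ (fderiv ℝ f) x :=
    ((hf.fderiv_right (m := ∞) le_rfl).differentiable (by simp)) x
  have h2 : IsSymmSndFDerivAt ℝ f x := (contDiff_infty.1 hf 2).contDiffAt.isSymmSndFDerivAt (by simp)
  have h3 : ∀ a b, fderiv ℝ (fun y => fderiv ℝ f y a) x b = fderiv ℝ (fderiv ℝ f) x b a := by
    intro a b
    rw [fderiv_clm_apply h1 (differentiableAt_const a)]
    simp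
  rw [h3, h3, h2.eq]

/-- Symmetry of the second derivative, applied at each order. It reduces convergence of difference
quotients in `C^∞` to a first-order statement about each iterated derivative. -/
theorem iteratedFDeriv_fderiv_apply {f : E → F} (hf : ContDiff ℝ ∞ f) (v : E) (n : ℕ) :
    iteratedFDeriv ℝ n (fun y => fderiv ℝ f y v) =
      fun y => fderiv ℝ (iteratedFDeriv ℝ n f) y v := by
  induction n with
  | zero =>
    ext y m
    rw [iteratedFDeriv_zero_apply, iteratedFDeriv_zero_eq_comp,
      (continuousMultilinearCurryFin0 ℝ E F).symm.comp_fderiv]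
    simp
  | succ n ih =>
    ext1 y
    have hn : ContDiff ℝ ∞ (iteratedFDeriv ℝ n f) :=
      hf.iteratedFDeriv_right (by exact_mod_cast le_top)
    have hd : DifferentiableAt ℝ (fderiv ℝ (iteratedFDeriv ℝ n f)) y :=
      ((hn.fderiv_right (m := ∞) le_rfl).differentiable (by simp)) y
    rw [iteratedFDeriv_succ_eq_comp_left, iteratedFDeriv_succ_eq_comp_left, Function.comp_apply,
      ih]
    have h := LinearIsometryEquiv.comp_fderiv (𝕜 := ℝ)
      (continuousMultilinearCurryLeftEquiv ℝ (fun _ : Fin (n + 1) => E) F).symm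
      (f := fderiv ℝ (iteratedFDeriv ℝ n f)) (x := y)
    refine Eq.trans ?_ (congrArg (fun L => L v) h).symm
    refine congrArg (continuousMultilinearCurryLeftEquiv ℝ (fun _ : Fin (n + 1) => E) F).symm ?_
    ext1 w
    rw [fderiv_fderiv_apply_comm hn, fderiv_clm_apply hd (differentiableAt_const w)]
    simp

end Derivatives

/-! ### Translation as a smooth map into the space of fields. -/

namespace SVect

theorem isPeriodic_iteratedFDeriv_lift (u : SVect d) (n : ℕ) :
    IsPeriodic (iteratedFDeriv ℝ n u.lift) := by
  induction n with
  | zero =>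
    intro x y h
    ext m
    simp [u.isPeriodic_lift h]
  | succ n ih =>
    intro x y h
    rw [iteratedFDeriv_succ_eq_comp_left, Function.comp_apply, Function.comp_apply, ih.fderiv h]

theorem contDiff_iteratedFDeriv_lift (u : SVect d) (n : ℕ) :
    ContDiff ℝ ∞ (iteratedFDeriv ℝ n u.lift) :=
  u.contDiff_lift.iteratedFDeriv_right (by exact_mod_cast le_top)

/-- The directional derivative `∂ₐ u`. -/
def dirDeriv (a : Space d) (u : SVect d) : SVect d :=
  ofLift (fun x => fderiv ℝ u.lift x a) (fun x y h => by simp only [u.isPeriodic_lift.fderiv h])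
    ((u.contDiff_lift.fderiv_right (m := ∞) le_rfl).clm_apply contDiff_const) fun x => by
      have hd : DifferentiableAt ℝ (fderiv ℝ u.lift) x :=
        ((u.contDiff_lift.fderiv_right (m := ∞) le_rfl).differentiable (by simp)) x
      have h0 : fderiv ℝ (divergence u.lift) x a = 0 := by
        rw [funext u.divergence_lift]; simp
      have hi : ∀ i : Fin d, HasFDerivAt (fun y => fderiv ℝ u.lift y (EuclideanSpace.single i 1) i)
          ((EuclideanSpace.proj i : Space d →L[ℝ] ℝ) ∘L
            fderiv ℝ (fun y => fderiv ℝ u.lift y (EuclideanSpace.single i 1)) x) x := by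
        intro i
        exact (EuclideanSpace.proj i : Space d →L[ℝ] ℝ).hasFDerivAt.comp x
          (hd.clm_apply (differentiableAt_const _)).hasFDerivAt
      have h1 : HasFDerivAt (divergence u.lift) _ x := HasFDerivAt.fun_sum fun i _ => hi i
      rw [h1.fderiv] at h0
      rw [divergence, ← h0]
      simp [fderiv_fderiv_apply_comm u.contDiff_lift x a]

theorem lift_dirDeriv (a : Space d) (u : SVect d) :
    (dirDeriv a u).lift = fun x => fderiv ℝ u.lift x a := lift_ofLift _ _ _ _

theorem iteratedFDeriv_lift_translate (b : Space d) (u : SVect d) (n : ℕ) :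
    iteratedFDeriv ℝ n (translate (proj b) u).lift =
      fun x => iteratedFDeriv ℝ n u.lift (x + b) := by
  rw [lift_translate_proj]
  ext1 x
  exact iteratedFDeriv_comp_add_right n b x

theorem continuous_translate (u : SVect d) : Continuous fun b : Torus d => translate b u := by
  rw [isOpenQuotientMap_proj.isQuotientMap.continuous_iff, continuous_iff_continuousAt]
  intro b
  rw [ContinuousAt, tendsto_nhds_iff]
  intro n
  simp only [Function.comp_apply, iteratedFDeriv_lift_translate]
  have hu := (u.isPeriodic_iteratedFDeriv_lift n).uniformContinuous
    (u.contDiff_iteratedFDeriv_lift n).continuous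
  rw [Metric.tendstoUniformly_iff]
  intro ε hε
  obtain ⟨δ, hδ, h⟩ := Metric.uniformContinuous_iff.1 hu ε hε
  filter_upwards [Metric.ball_mem_nhds b hδ] with c hc x
  apply h
  rw [dist_add_left, dist_comm]
  exact hc

/-- For each iterated derivative `A`, the mean value inequality is applied to `t ↦ A (z + t a) - t
∂ₐA(z)`. Its derivative `∂ₐA(z + t a) - ∂ₐA(z)` is small uniformly in `z`, because `∂ₐA` is periodic
and continuous. -/
theorem tendsto_slope_translate (u : SVect d) (b a : Space d) :
    Tendsto (fun s : ℝ => s⁻¹ • (translate (proj (b + s • a)) u - translate (proj b) u)) (𝓝[≠] 0)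
      (𝓝 (translate (proj b) (dirDeriv a u))) := by
  rw [tendsto_nhds_iff]
  intro n
  set A := iteratedFDeriv ℝ n u.lift with hA
  have hAs : ContDiff ℝ ∞ A := u.contDiff_iteratedFDeriv_lift n
  have hAp : IsPeriodic A := u.isPeriodic_iteratedFDeriv_lift n
  have e1 : iteratedFDeriv ℝ n (translate (proj b) (dirDeriv a u)).lift =
      fun x => fderiv ℝ A (x + b) a := by
    rw [iteratedFDeriv_lift_translate, lift_dirDeriv, iteratedFDeriv_fderiv_apply u.contDiff_lift]
  have e2 : ∀ s : ℝ, iteratedFDeriv ℝ n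
      (s⁻¹ • (translate (proj (b + s • a)) u - translate (proj b) u)).lift =
      fun x => s⁻¹ • (A (x + b + s • a) - A (x + b)) := by
    intro s
    ext1 x
    have hc : ∀ v : SVect d, ContDiffAt ℝ n v.lift x := fun v =>
      (v.contDiff_lift.of_le (by exact_mod_cast le_top)).contDiffAt
    rw [lift_smul, iteratedFDeriv_const_smul_apply (hc _), lift_sub,
      iteratedFDeriv_sub_apply (hc _) (hc _), iteratedFDeriv_lift_translate,
      iteratedFDeriv_lift_translate, add_assoc]
  simp only [e1, e2]
  have hu : UniformContinuous fun x => fderiv ℝ A x a :=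
    IsPeriodic.uniformContinuous (fun x y h => by simp only [hAp.fderiv h])
      ((hAs.continuous_fderiv (by simp)).clm_apply continuous_const)
  rw [Metric.tendstoUniformly_iff]
  intro ε hε
  obtain ⟨δ, hδ, h⟩ := Metric.uniformContinuous_iff.1 hu (ε / 2) (half_pos hε)
  have ht : Tendsto (fun s : ℝ => s • a) (𝓝 0) (𝓝 0) := by
    have : Continuous fun s : ℝ => s • a := by fun_prop
    simpa using this.tendsto 0
  obtain ⟨r, hr, hr'⟩ := Metric.mem_nhds_iff.1 (ht (Metric.ball_mem_nhds 0 hδ))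
  filter_upwards [nhdsWithin_le_nhds (Metric.ball_mem_nhds (0 : ℝ) hr), self_mem_nhdsWithin]
    with s hs hs0 x
  have hs0 : s ≠ 0 := hs0
  set z := x + b
  have hder : ∀ t ∈ Metric.ball (0 : ℝ) r, HasDerivWithinAt
      (fun t : ℝ => A (z + t • a) - t • fderiv ℝ A z a)
      (fderiv ℝ A (z + t • a) a - fderiv ℝ A z a) (Metric.ball 0 r) t := by
    intro t _
    have h1 : HasDerivAt (fun t : ℝ => z + t • a) a t := by
      simpa using ((hasDerivAt_id t).smul_const a).const_add z
    have h2 := ((hAs.differentiable (by simp)) (z + t • a)).hasFDerivAt.comp_hasDerivAt t h1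
    have h3 : HasDerivAt (fun t : ℝ => t • fderiv ℝ A z a) (fderiv ℝ A z a) t := by
      simpa using (hasDerivAt_id t).smul_const (fderiv ℝ A z a)
    exact (h2.sub h3).hasDerivWithinAt
  have hb : ∀ t ∈ Metric.ball (0 : ℝ) r, ‖fderiv ℝ A (z + t • a) a - fderiv ℝ A z a‖ ≤ ε / 2 := by
    intro t ht
    rw [← dist_eq_norm]
    refine (h ?_).le
    have := hr' ht
    simpa [dist_eq_norm] using this
  have := (convex_ball (0 : ℝ) r).norm_image_sub_le_of_norm_hasDerivWithin_le hder hb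
    (Metric.mem_ball_self hr) hs
  simp only [zero_smul, add_zero, sub_zero] at this
  rw [dist_comm, dist_eq_norm]
  have e3 : s⁻¹ • (A (z + s • a) - A z) - fderiv ℝ A z a =
      s⁻¹ • (A (z + s • a) - s • fderiv ℝ A z a - A z) := by
    rw [sub_right_comm, smul_sub _ (_ - _) (_ • _), smul_smul, inv_mul_cancel₀ hs0, one_smul]
  rw [e3, norm_smul, norm_inv]
  calc ‖s‖⁻¹ * _ ≤ ‖s‖⁻¹ * (ε / 2 * ‖s‖) := by gcongr
    _ = ε / 2 := by field_simp [norm_ne_zero_iff.2 hs0]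
    _ < ε := half_lt_self hε

end SVect

end EulerTorus

/-! ### The circular flow and its pressure on `ℝᵈ`. -/

namespace EulerTorus

variable {d : ℕ}

theorem gradient_apply (f : Space d → ℝ) (x : Space d) (i : Fin d) :
    gradient f x i = fderiv ℝ f x (EuclideanSpace.single i 1) := by
  rw [← inner_gradient_left, EuclideanSpace.inner_single_right]
  simp

/-- The representative in `[-π, π)` of a point of the circle. -/
def residue (X : AddCircle (2 * Real.pi)) : ℝ := AddCircle.equivIco (2 * Real.pi) (-Real.pi) X

theorem coe_residue (X : AddCircle (2 * Real.pi)) :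
    (residue X : AddCircle (2 * Real.pi)) = X := AddCircle.coe_equivIco

theorem residue_mem (X : AddCircle (2 * Real.pi)) : residue X ∈ Set.Ico (-Real.pi) Real.pi := by
  have := (AddCircle.equivIco (2 * Real.pi) (-Real.pi) X).2
  exact ⟨this.1, this.2.trans_eq (by ring)⟩

theorem residue_coe {x : ℝ} (hx : |x| < Real.pi) : residue (x : AddCircle (2 * Real.pi)) = x := by
  apply AddCircle.equivIco_coe_of_mem
  rw [abs_lt] at hx
  constructor <;> linarith

theorem residue_zero : residue 0 = 0 := by
  simpa using residue_coe (x := 0) (by simpa using Real.pi_pos)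

theorem abs_residue (X : AddCircle (2 * Real.pi)) : |residue X| = ‖X‖ := by
  have h := residue_mem X
  have h2 : ‖(residue X : AddCircle (2 * Real.pi))‖ = |residue X| := by
    rw [AddCircle.norm_coe_eq_abs_iff _ Real.two_pi_pos.ne', abs_of_pos Real.two_pi_pos, abs_le]
    constructor <;> linarith [h.1, h.2]
  rw [← h2, coe_residue]

theorem residue_sq (X : AddCircle (2 * Real.pi)) : residue X ^ 2 = ‖X‖ ^ 2 := by
  rw [← abs_residue, sq_abs]

theorem residue_eq_zero {X : AddCircle (2 * Real.pi)} : residue X = 0 ↔ X = 0 := by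
  rw [← abs_eq_zero, abs_residue, norm_eq_zero]

/-- Away from the point antipodal to `Y`, where the representative jumps, the residue is locally the
real coordinate up to a constant. -/
theorem eventually_residue_eq {Y : AddCircle (2 * Real.pi)} {x₀ : ℝ}
    (h : ‖(x₀ : AddCircle (2 * Real.pi)) - Y‖ < Real.pi) :
    ∀ᶠ x : ℝ in 𝓝 x₀, residue ((x : AddCircle (2 * Real.pi)) - Y) =
      x - (x₀ - residue ((x₀ : AddCircle (2 * Real.pi)) - Y)) := by
  set r := residue ((x₀ : AddCircle (2 * Real.pi)) - Y) with hr
  have hc : ((x₀ - r : ℝ) : AddCircle (2 * Real.pi)) = Y := by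
    rw [AddCircle.coe_sub, hr, coe_residue]; simp
  have hcont : Continuous fun x : ℝ => |x - (x₀ - r)| := by fun_prop
  have hlt : |x₀ - (x₀ - r)| < Real.pi := by
    rw [sub_sub_cancel, hr, abs_residue]; exact h
  filter_upwards [hcont.continuousAt.eventually_lt continuousAt_const hlt] with x hx
  rw [← residue_coe hx, AddCircle.coe_sub, hc]

/-- The angular velocity, as a function of the squared distance to the centre, of the circular
flow with vorticity supported in the disk of radius `ε`. -/
def angularVelocity (ε s : ℝ) : ℝ := expNegInvGlue (ε ^ 2 - s)

theorem contDiff_angularVelocity (ε : ℝ) : ContDiff ℝ ∞ (angularVelocity ε) :=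
  (expNegInvGlue.contDiff (n := ⊤)).comp (contDiff_const.sub contDiff_id)

theorem angularVelocity_eq_zero_iff {ε s : ℝ} : angularVelocity ε s = 0 ↔ ε ^ 2 ≤ s := by
  rw [angularVelocity, expNegInvGlue.zero_iff_nonpos, sub_nonpos]

theorem angularVelocity_lt {ε s t : ℝ} (hs : s < ε ^ 2) (h : s < t) :
    angularVelocity ε t < angularVelocity ε s := by
  rcases le_or_gt (ε ^ 2) t with ht | ht
  · rw [angularVelocity_eq_zero_iff.2 ht]
    exact expNegInvGlue.pos_of_pos (sub_pos.2 hs)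
  · have h1 : 0 < ε ^ 2 - s := sub_pos.2 hs
    have h2 : 0 < ε ^ 2 - t := sub_pos.2 ht
    rw [angularVelocity, angularVelocity, expNegInvGlue, expNegInvGlue, if_neg h1.not_ge,
      if_neg h2.not_ge, Real.exp_lt_exp, neg_lt_neg_iff]
    exact inv_strictAnti₀ h2 (by linarith)

/-- The pressure of the circular flow with angular velocity `angularVelocity ε`. -/
def radialPressure (ε s : ℝ) : ℝ := ∫ t in (ε ^ 2)..s, angularVelocity ε t ^ 2 / 2

theorem hasDerivAt_radialPressure (ε s : ℝ) :
    HasDerivAt (radialPressure ε) (angularVelocity ε s ^ 2 / 2) s :=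
  ((((contDiff_angularVelocity ε).continuous.pow 2).div_const 2).integral_hasStrictDerivAt
    (ε ^ 2) s).hasDerivAt

theorem contDiff_radialPressure (ε : ℝ) : ContDiff ℝ ∞ (radialPressure ε) := by
  rw [contDiff_infty_iff_deriv]
  refine ⟨fun s => (hasDerivAt_radialPressure ε s).differentiableAt, ?_⟩
  rw [funext fun s => (hasDerivAt_radialPressure ε s).deriv]
  exact ((contDiff_angularVelocity ε).pow 2).div_const 2

/-- The primitive is based at `ε ^ 2`, beyond which the angular velocity vanishes; this lets the
pressure be cut off and placed on the torus. -/
theorem radialPressure_eq_zero {ε s : ℝ} (h : ε ^ 2 ≤ s) : radialPressure ε s = 0 := by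
  apply intervalIntegral.integral_zero_ae
  refine Eventually.of_forall fun t ht => ?_
  rw [Set.uIoc_of_le h] at ht
  rw [angularVelocity_eq_zero_iff.2 ht.1.le]
  norm_num

section Model

variable (a l : Fin d) (ε : ℝ)

/-- The circular flow in the plane of the coordinates `a`, `l` of `ℝᵈ`. -/
def circularFlow (x : Space d) : Space d :=
  angularVelocity ε (x a ^ 2 + x l ^ 2) •
    (x l • EuclideanSpace.single a (1 : ℝ) - x a • EuclideanSpace.single l (1 : ℝ))

/-- The pressure of the circular flow. -/
def circularPressure (x : Space d) : ℝ := radialPressure ε (x a ^ 2 + x l ^ 2)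

theorem contDiff_coord (i : Fin d) : ContDiff ℝ ∞ fun x : Space d => x i :=
  (EuclideanSpace.proj i : Space d →L[ℝ] ℝ).contDiff

theorem contDiff_circularFlow : ContDiff ℝ ∞ (circularFlow a l ε) :=
  ((contDiff_angularVelocity ε).comp
    (((contDiff_coord a).pow 2).add ((contDiff_coord l).pow 2))).smul
    (((contDiff_coord l).smul contDiff_const).sub ((contDiff_coord a).smul contDiff_const))

theorem contDiff_circularPressure : ContDiff ℝ ∞ (circularPressure a l ε) :=
  (contDiff_radialPressure ε).comp (((contDiff_coord a).pow 2).add ((contDiff_coord l).pow 2))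

theorem hasFDerivAt_coord (i : Fin d) (x : Space d) :
    HasFDerivAt (fun x : Space d => x i) (EuclideanSpace.proj i : Space d →L[ℝ] ℝ) x :=
  (EuclideanSpace.proj i : Space d →L[ℝ] ℝ).hasFDerivAt

theorem fderiv_circularFlow (x v : Space d) :
    fderiv ℝ (circularFlow a l ε) x v =
      (deriv (angularVelocity ε) (x a ^ 2 + x l ^ 2) * (2 * (x a * v a + x l * v l))) •
        (x l • EuclideanSpace.single a (1 : ℝ) - x a • EuclideanSpace.single l (1 : ℝ)) +
      angularVelocity ε (x a ^ 2 + x l ^ 2) •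
        (v l • EuclideanSpace.single a (1 : ℝ) - v a • EuclideanSpace.single l (1 : ℝ)) := by
  have h1 := ((contDiff_angularVelocity ε).differentiable (by simp)
    (x a ^ 2 + x l ^ 2)).hasDerivAt.comp_hasFDerivAt x
      (((hasFDerivAt_coord a x).pow 2).add ((hasFDerivAt_coord l x).pow 2))
  have h2 := ((hasFDerivAt_coord l x).smul_const (EuclideanSpace.single a (1 : ℝ))).sub
    ((hasFDerivAt_coord a x).smul_const (EuclideanSpace.single l (1 : ℝ)))
  have h3 : HasFDerivAt (circularFlow a l ε) _ x := h1.smul h2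
  rw [h3.fderiv]
  simp only [_root_.add_apply, _root_.smul_apply,
    ContinuousLinearMap.smulRight_apply, _root_.sub_apply, PiLp.proj_apply,
    smul_eq_mul, Function.comp_apply, Pi.add_apply]
  rw [add_comm]
  congr 2
  simp only [nsmul_eq_mul, Nat.cast_ofNat, Nat.add_one_sub_one, pow_one]
  ring

variable {a l}

theorem divergence_circularFlow (hal : a ≠ l) (x : Space d) :
    divergence (circularFlow a l ε) x = 0 := by
  simp only [divergence, fderiv_circularFlow, PiLp.add_apply, PiLp.smul_apply, PiLp.sub_apply,
    PiLp.single_apply, smul_eq_mul]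
  simp [mul_sub, mul_add, Finset.sum_add_distrib, Finset.sum_sub_distrib, hal, hal.symm, add_mul]
  ring

/-- The acceleration is centripetal: `-ω²` times the radial vector in the plane. The pressure is a
function of the squared radius with derivative `ω² / 2`, and the gradient of the squared radius is
twice the radial vector. -/
theorem euler_circularFlow (hal : a ≠ l) (x : Space d) :
    fderiv ℝ (circularFlow a l ε) x (circularFlow a l ε x) +
      gradient (circularPressure a l ε) x = 0 := by
  have h1 := (hasDerivAt_radialPressure ε (x a ^ 2 + x l ^ 2)).comp_hasFDerivAt x
      (((hasFDerivAt_coord a x).pow 2).add ((hasFDerivAt_coord l x).pow 2))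
  have h2 : HasFDerivAt (circularPressure a l ε) _ x := h1
  have ha : circularFlow a l ε x a = angularVelocity ε (x a ^ 2 + x l ^ 2) * x l := by
    simp [circularFlow, hal]
  have hl : circularFlow a l ε x l = -(angularVelocity ε (x a ^ 2 + x l ^ 2) * x a) := by
    simp [circularFlow, hal.symm]
  ext i
  rw [PiLp.add_apply, gradient_apply, fderiv_circularFlow, ha, hl, h2.fderiv]
  simp [PiLp.single_apply, eq_comm (a := a), eq_comm (a := l)]
  split_ifs <;> ring

end Model

end EulerTorus

/-! ### Vortices and shear flows on the torus. -/

namespace EulerTorus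

variable {d : ℕ}

theorem continuous_proj_apply (i : Fin d) : Continuous fun x : Space d => proj x i :=
  (continuous_apply i).comp isOpenQuotientMap_proj.continuous

/-- The circular flow in the plane of the coordinates `a`, `l`, centred at `c ∈ 𝕋ᵈ`. -/
def vortexField (a l : Fin d) (ε : ℝ) (c X : Torus d) : Space d :=
  angularVelocity ε (residue (X a - c a) ^ 2 + residue (X l - c l) ^ 2) •
    (residue (X l - c l) • EuclideanSpace.single a (1 : ℝ) -
      residue (X a - c a) • EuclideanSpace.single l (1 : ℝ))

/-- The pressure of `vortexField`. -/
def vortexPressure (a l : Fin d) (ε : ℝ) (c X : Torus d) : ℝ :=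
  radialPressure ε (residue (X a - c a) ^ 2 + residue (X l - c l) ^ 2)

section

variable {a l : Fin d} {ε : ℝ}

theorem vortexField_eq_zero {c X : Torus d} (h : ε ^ 2 ≤ ‖X a - c a‖ ^ 2 + ‖X l - c l‖ ^ 2) :
    vortexField a l ε c X = 0 := by
  rw [vortexField, residue_sq, residue_sq, angularVelocity_eq_zero_iff.2 h, zero_smul]

theorem vortexPressure_eq_zero {c X : Torus d} (h : ε ^ 2 ≤ ‖X a - c a‖ ^ 2 + ‖X l - c l‖ ^ 2) :
    vortexPressure a l ε c X = 0 := by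
  rw [vortexPressure, residue_sq, residue_sq, radialPressure_eq_zero h]

/-- Local model on `ℝᵈ`: smoothness, zero divergence and the Euler equation are all inherited from
the circular flow through it. -/
theorem exists_eventuallyEq_circularFlow (hal : a ≠ l) (hε : 0 < ε) (hε' : ε < Real.pi)
    (c : Torus d) (x₀ : Space d) : ∃ b : Space d,
      (x₀ - b) a = residue (proj x₀ a - c a) ∧ (x₀ - b) l = residue (proj x₀ l - c l) ∧
      (fun x => vortexField a l ε c (proj x)) =ᶠ[𝓝 x₀] (fun x => circularFlow a l ε (x - b)) ∧
      (fun x => vortexPressure a l ε c (proj x)) =ᶠ[𝓝 x₀]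
        (fun x => circularPressure a l ε (x - b)) := by
  set ra := residue (proj x₀ a - c a) with hra
  set rl := residue (proj x₀ l - c l) with hrl
  set b : Space d := (x₀ a - ra) • EuclideanSpace.single a (1 : ℝ) +
    (x₀ l - rl) • EuclideanSpace.single l (1 : ℝ) with hb
  have hba : b a = x₀ a - ra := by simp [hb, hal]
  have hbl : b l = x₀ l - rl := by simp [hb, hal.symm]
  have h1 : (x₀ - b) a = ra := by rw [PiLp.sub_apply, hba]; ring
  have h2 : (x₀ - b) l = rl := by rw [PiLp.sub_apply, hbl]; ring
  have hcc : ∀ i : Fin d, ContinuousAt (fun x : Space d => x i) x₀ := fun i =>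
    (contDiff_coord i).continuous.continuousAt
  refine ⟨b, h1, h2, ?_⟩
  by_cases h : ‖proj x₀ a - c a‖ < Real.pi ∧ ‖proj x₀ l - c l‖ < Real.pi
  · have ea := (hcc a).eventually (eventually_residue_eq h.1)
    have el := (hcc l).eventually (eventually_residue_eq h.2)
    have key : ∀ᶠ x in 𝓝 x₀, residue (proj x a - c a) = (x - b) a ∧
        residue (proj x l - c l) = (x - b) l := by
      filter_upwards [ea, el] with x hxa hxl
      rw [PiLp.sub_apply, PiLp.sub_apply, hba, hbl]
      exact ⟨hxa, hxl⟩
    constructor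
    · filter_upwards [key] with x hx
      rw [vortexField, circularFlow, hx.1, hx.2]
    · filter_upwards [key] with x hx
      rw [vortexPressure, circularPressure, hx.1, hx.2]
  -- Here the residue may jump, but some coordinate is at distance at least `π > ε` from the centre,
  -- so both sides vanish near `x₀`.
  · have hlt : ε ^ 2 < ‖proj x₀ a - c a‖ ^ 2 + ‖proj x₀ l - c l‖ ^ 2 := by
      have : ε ^ 2 < Real.pi ^ 2 := by gcongr
      rw [not_and_or, not_lt, not_lt] at h
      rcases h with h | h
      · have : Real.pi ^ 2 ≤ ‖proj x₀ a - c a‖ ^ 2 := by gcongr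
        nlinarith [sq_nonneg ‖proj x₀ l - c l‖]
      · have : Real.pi ^ 2 ≤ ‖proj x₀ l - c l‖ ^ 2 := by gcongr
        nlinarith [sq_nonneg ‖proj x₀ a - c a‖]
    have hc1 : Continuous fun x : Space d => ‖proj x a - c a‖ ^ 2 + ‖proj x l - c l‖ ^ 2 :=
      ((((continuous_proj_apply a).sub continuous_const).norm).pow 2).add
        ((((continuous_proj_apply l).sub continuous_const).norm).pow 2)
    have hc2 : Continuous fun x : Space d => (x - b) a ^ 2 + (x - b) l ^ 2 :=
      (((contDiff_coord a).continuous.comp (continuous_id.sub continuous_const)).pow 2).add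
        (((contDiff_coord l).continuous.comp (continuous_id.sub continuous_const)).pow 2)
    have e1 := (continuousAt_const (y := ε ^ 2)).eventually_lt hc1.continuousAt hlt
    have e2 := (continuousAt_const (y := ε ^ 2)).eventually_lt (hc2.continuousAt (x := x₀))
      (by rw [h1, h2, hra, hrl, residue_sq, residue_sq]; exact hlt)
    constructor
    · filter_upwards [e1, e2] with x hx1 hx2
      rw [vortexField_eq_zero hx1.le, circularFlow, angularVelocity_eq_zero_iff.2 hx2.le, zero_smul]
    · filter_upwards [e1, e2] with x hx1 hx2
      rw [vortexPressure_eq_zero hx1.le, circularPressure, radialPressure_eq_zero hx2.le]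

theorem contDiff_vortexPressure (hal : a ≠ l) (hε : 0 < ε) (hε' : ε < Real.pi) (c : Torus d) :
    ContDiff ℝ ∞ fun x => vortexPressure a l ε c (proj x) := by
  rw [contDiff_iff_contDiffAt]
  intro x₀
  obtain ⟨b, -, -, -, h⟩ := exists_eventuallyEq_circularFlow hal hε hε' c x₀
  exact ((contDiff_circularPressure a l ε).comp
    (contDiff_id.sub contDiff_const)).contDiffAt.congr_of_eventuallyEq h

/-- `vortexField` as an element of `SVect`. -/
def vortex (hal : a ≠ l) (hε : 0 < ε) (hε' : ε < Real.pi) (c : Torus d) : SVect d :=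
  ⟨vortexField a l ε c, by
    constructor
    · rw [contDiff_iff_contDiffAt]
      intro x₀
      obtain ⟨b, -, -, h, -⟩ := exists_eventuallyEq_circularFlow hal hε hε' c x₀
      exact ((contDiff_circularFlow a l ε).comp
        (contDiff_id.sub contDiff_const)).contDiffAt.congr_of_eventuallyEq h
    · intro x₀
      obtain ⟨b, -, -, h, -⟩ := exists_eventuallyEq_circularFlow hal hε hε' c x₀
      rw [divergence, h.fderiv_eq, fderiv_comp_sub]
      exact divergence_circularFlow ε hal _⟩

variable (hal : a ≠ l) (hε : 0 < ε) (hε' : ε < Real.pi) (c : Torus d)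

theorem fderiv_vortex_lift (x : Space d) : ∃ y : Space d, y a = residue (proj x a - c a) ∧
    y l = residue (proj x l - c l) ∧
    fderiv ℝ (vortex hal hε hε' c).lift x = fderiv ℝ (circularFlow a l ε) y := by
  obtain ⟨b, h1, h2, h, -⟩ := exists_eventuallyEq_circularFlow hal hε hε' c x
  exact ⟨x - b, h1, h2, by rw [← fderiv_comp_sub]; exact h.fderiv_eq⟩

theorem euler_vortex (x : Space d) :
    fderiv ℝ (vortex hal hε hε' c).lift x ((vortex hal hε hε' c).lift x) +
      gradient (fun y => vortexPressure a l ε c (proj y)) x = 0 := by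
  obtain ⟨b, -, -, h, h'⟩ := exists_eventuallyEq_circularFlow hal hε hε' c x
  have e1 : fderiv ℝ (vortex hal hε hε' c).lift x = fderiv ℝ (circularFlow a l ε) (x - b) := by
    rw [← fderiv_comp_sub]; exact h.fderiv_eq
  have e2 : (vortex hal hε hε' c).lift x = circularFlow a l ε (x - b) := h.eq_of_nhds
  have e3 : gradient (fun y => vortexPressure a l ε c (proj y)) x =
      gradient (circularPressure a l ε) (x - b) := by
    rw [gradient, gradient, h'.fderiv_eq, fderiv_comp_sub]
  rw [e1, e2, e3, euler_circularFlow ε hal]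

theorem vortex_lift_eq_zero {x : Space d} (h : ε ≤ ‖proj x l - c l‖) :
    (vortex hal hε hε' c).lift x = 0 := by
  apply vortexField_eq_zero
  have : ε ^ 2 ≤ ‖proj x l - c l‖ ^ 2 := by gcongr
  nlinarith [sq_nonneg ‖proj x a - c a‖]

theorem fderiv_vortex_lift_eq_zero {x : Space d} (h : ε < ‖proj x l - c l‖) :
    fderiv ℝ (vortex hal hε hε' c).lift x = 0 := by
  have hc : Continuous fun x : Space d => ‖proj x l - c l‖ :=
    ((continuous_proj_apply l).sub continuous_const).norm
  have : (vortex hal hε hε' c).lift =ᶠ[𝓝 x] fun _ => 0 := by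
    filter_upwards [continuousAt_const.eventually_lt hc.continuousAt h] with y hy
    exact vortex_lift_eq_zero hal hε hε' c hy.le
  rw [this.fderiv_eq, fderiv_const_apply]

theorem vortex_translate (b : Torus d) :
    (vortex hal hε hε' c).translate b = vortex hal hε hε' (c - b) := by
  apply Subtype.ext
  ext1 X
  change vortexField a l ε c (X + b) = vortexField a l ε (c - b) X
  simp only [vortexField, Pi.add_apply, Pi.sub_apply]
  rw [show X a + b a - c a = X a - (c a - b a) by abel,
    show X l + b l - c l = X l - (c l - b l) by abel]

end

/-- A smooth profile on the circle, equal to `1` on `‖Y‖ ≤ ε` and to `0` on `2 * ε ≤ ‖Y‖`. -/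
def plateau (ε : ℝ) (Y : AddCircle (2 * Real.pi)) : ℝ :=
  Real.smoothTransition (((2 * ε) ^ 2 - ‖Y‖ ^ 2) / (3 * ε ^ 2))

theorem plateau_eq_one {ε : ℝ} (hε : 0 < ε) {Y : AddCircle (2 * Real.pi)} (h : ‖Y‖ ≤ ε) :
    plateau ε Y = 1 := by
  apply Real.smoothTransition.one_of_one_le
  rw [le_div_iff₀ (by positivity)]
  nlinarith [norm_nonneg Y]

theorem plateau_eq_zero {ε : ℝ} (hε : 0 < ε) {Y : AddCircle (2 * Real.pi)} (h : 2 * ε ≤ ‖Y‖) :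
    plateau ε Y = 0 := by
  apply Real.smoothTransition.zero_of_nonpos
  apply div_nonpos_of_nonpos_of_nonneg _ (by positivity)
  nlinarith [norm_nonneg Y]

theorem contDiff_plateau {ε : ℝ} (hε : 0 < ε) (hε' : 2 * ε < Real.pi)
    (Y : AddCircle (2 * Real.pi)) :
    ContDiff ℝ ∞ fun x : ℝ => plateau ε ((x : AddCircle (2 * Real.pi)) - Y) := by
  rw [contDiff_iff_contDiffAt]
  intro x₀
  by_cases h : ‖(x₀ : AddCircle (2 * Real.pi)) - Y‖ < Real.pi
  · have hs : ∀ b : ℝ, ContDiff ℝ ∞ fun x : ℝ =>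
        Real.smoothTransition (((2 * ε) ^ 2 - (x - b) ^ 2) / (3 * ε ^ 2)) := fun b =>
      (Real.smoothTransition.contDiff (n := ⊤)).comp
        ((contDiff_const.sub ((contDiff_id.sub contDiff_const).pow 2)).div_const _)
    refine (hs (x₀ - residue ((x₀ : AddCircle (2 * Real.pi)) - Y))).contDiffAt.congr_of_eventuallyEq ?_
    filter_upwards [eventually_residue_eq h] with x hx
    rw [plateau, ← residue_sq, hx]
  · have hc : Continuous fun x : ℝ => ‖(x : AddCircle (2 * Real.pi)) - Y‖ :=
      ((AddCircle.continuous_mk' _).sub continuous_const).norm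
    refine (contDiffAt_const (c := (0 : ℝ))).congr_of_eventuallyEq ?_
    filter_upwards [continuousAt_const.eventually_lt hc.continuousAt
      (hε'.trans_le (not_lt.1 h))] with x hx
    exact plateau_eq_zero hε hx.le

theorem hasFDerivAt_comp_coord_smul (a l : Fin d) (f : AddCircle (2 * Real.pi) → ℝ)
    (hf : ContDiff ℝ ∞ fun x : ℝ => f x) (x : Space d) :
    HasFDerivAt (fun x : Space d => f (proj x l) • EuclideanSpace.single a (1 : ℝ))
      ((deriv (fun x : ℝ => f x) (x l) • (EuclideanSpace.proj l : Space d →L[ℝ] ℝ)).smulRight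
        (EuclideanSpace.single a (1 : ℝ))) x := by
  have h := (hf.differentiable (by simp) (x l)).hasDerivAt.comp_hasFDerivAt x
    (hasFDerivAt_coord l x)
  exact h.smul_const (EuclideanSpace.single a (1 : ℝ))

/-- The shear flow `f (x_l) e_a`. -/
def shear {a l : Fin d} (hal : a ≠ l) (f : AddCircle (2 * Real.pi) → ℝ)
    (hf : ContDiff ℝ ∞ fun x : ℝ => f x) : SVect d :=
  ⟨fun X => f (X l) • EuclideanSpace.single a (1 : ℝ), by
    constructor
    · exact (hf.comp (contDiff_coord l)).smul contDiff_const
    · intro x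
      rw [divergence]
      simp only [(hasFDerivAt_comp_coord_smul a l f hf x).fderiv,
        ContinuousLinearMap.smulRight_apply, _root_.smul_apply, PiLp.proj_apply, PiLp.smul_apply,
        PiLp.single_apply, smul_eq_mul]
      simp [hal.symm]⟩

theorem shear_lift {a l : Fin d} (hal : a ≠ l) (f : AddCircle (2 * Real.pi) → ℝ)
    (hf : ContDiff ℝ ∞ fun x : ℝ => f x) (x : Space d) :
    (shear hal f hf).lift x = f (proj x l) • EuclideanSpace.single a (1 : ℝ) := rfl

theorem fderiv_shear_lift {a l : Fin d} (hal : a ≠ l) (f : AddCircle (2 * Real.pi) → ℝ)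
    (hf : ContDiff ℝ ∞ fun x : ℝ => f x) (x v : Space d) :
    fderiv ℝ (shear hal f hf).lift x v =
      (deriv (fun x : ℝ => f x) (x l) * v l) • EuclideanSpace.single a (1 : ℝ) := by
  have h : HasFDerivAt (shear hal f hf).lift _ x := hasFDerivAt_comp_coord_smul a l f hf x
  rw [h.fderiv]
  simp

end EulerTorus

/-! ### Tools for the energy estimate: divergence theorem, Gronwall, differentiation under the
integral. -/

namespace EulerTorus

open MeasureTheory
open scoped RealInnerProductSpace

section Divergence

variable {d : ℕ}

theorem divergence_smul {φ : Space d → ℝ} {u : Space d → Space d} {x : Space d}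
    (hφ : DifferentiableAt ℝ φ x) (hu : DifferentiableAt ℝ u x) :
    divergence (fun y => φ y • u y) x = fderiv ℝ φ x (u x) + φ x * divergence u x := by
  have h : fderiv ℝ φ x (u x) = ∑ i, u x i * fderiv ℝ φ x (EuclideanSpace.single i 1) := by
    conv_lhs => rw [← (EuclideanSpace.basisFun (Fin d) ℝ).sum_repr (u x)]
    simp
  rw [divergence, (hφ.hasFDerivAt.fun_smul hu.hasFDerivAt).fderiv, h, divergence, Finset.mul_sum,
    ← Finset.sum_add_distrib]
  refine Finset.sum_congr rfl fun i _ => ?_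
  simp
  ring

theorem divergence_add {u v : Space d → Space d} {x : Space d}
    (hu : DifferentiableAt ℝ u x) (hv : DifferentiableAt ℝ v x) :
    divergence (fun y => u y + v y) x = divergence u x + divergence v x := by
  rw [divergence, (hu.hasFDerivAt.fun_add hv.hasFDerivAt).fderiv, divergence, divergence,
    ← Finset.sum_add_distrib]
  simp

/-- The fundamental cube of the torus. -/
abbrev cube (d : ℕ) : Set (Fin d → ℝ) := Set.Icc 0 fun _ => 2 * Real.pi

instance : IsFiniteMeasure (volume.restrict (cube d)) :=
  ⟨by simpa using (isCompact_Icc : IsCompact (cube d)).measure_lt_top⟩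

theorem continuous_toLp : Continuous fun y : Fin d → ℝ => (WithLp.toLp 2 y : Space d) :=
  (EuclideanSpace.equiv (Fin d) ℝ).symm.continuous

theorem integral_divergence_eq_zero {n : ℕ} {u : Space (n + 1) → Space (n + 1)}
    (hu : ContDiff ℝ 1 u) (hp : IsPeriodic u) :
    ∫ y in cube (n + 1), divergence u (WithLp.toLp 2 y) = 0 := by
  have hd : Differentiable ℝ u := hu.differentiable (by simp)
  have key := integral_divergence_of_hasFDerivAt_off_countable' (E := ℝ) (0 : Fin (n + 1) → ℝ)
    (fun _ => 2 * Real.pi) (fun _ => Real.two_pi_pos.le)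
    (fun i y => u (WithLp.toLp 2 y) i)
    (fun i y => (EuclideanSpace.proj i : Space (n + 1) →L[ℝ] ℝ) ∘L
      (fderiv ℝ u (WithLp.toLp 2 y)) ∘L
        ((EuclideanSpace.equiv (Fin (n + 1)) ℝ).symm : (Fin (n + 1) → ℝ) →L[ℝ] Space (n + 1)))
    ∅ Set.countable_empty
    (fun i => (((contDiff_coord i).continuous.comp hu.continuous).comp
      continuous_toLp).continuousOn)
    (fun y _ i => (EuclideanSpace.proj i : Space (n + 1) →L[ℝ] ℝ).hasFDerivAt.comp y
      ((hd _).hasFDerivAt.comp y (EuclideanSpace.equiv (Fin (n + 1)) ℝ).symm.hasFDerivAt))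
    (by
      refine ContinuousOn.integrableOn_compact isCompact_Icc (Continuous.continuousOn ?_)
      refine continuous_finsetSum _ fun i _ => ?_
      exact (contDiff_coord i).continuous.comp
        (((hu.continuous_fderiv (by simp)).comp continuous_toLp).clm_apply continuous_const))
  refine Eq.trans ?_ (key.trans ?_)
  · rfl
  · refine Finset.sum_eq_zero fun i _ => ?_
    rw [sub_eq_zero]
    -- The fluxes through opposite faces cancel, since corresponding points differ by a period.
    refine congrArg _ (funext fun y => ?_)
    refine congrArg (fun z : Space (n + 1) => z i) (hp ?_)
    ext j
    refine Fin.succAboveCases i ?_ (fun k => ?_) j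
    · simp [proj]
    · simp [proj]

end Divergence

section Gronwall

/-- Gronwall in both time directions: `exp (-M t) E t` is nonincreasing, which settles `T ≥ 0`, and
`exp (M t) E t` is nondecreasing, which settles `T ≤ 0`. -/
theorem eq_zero_of_abs_deriv_le {E E' : ℝ → ℝ} {M T : ℝ} (hc : ContinuousOn E (Set.uIcc 0 T))
    (hd : ∀ t ∈ interior (Set.uIcc 0 T), HasDerivAt E (E' t) t)
    (hb : ∀ t ∈ interior (Set.uIcc 0 T), |E' t| ≤ M * E t) (h0 : E 0 = 0) (hT : 0 ≤ E T) :
    E T = 0 := by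
  have hder : ∀ c : ℝ, ∀ t ∈ interior (Set.uIcc 0 T),
      HasDerivAt (fun t => Real.exp (c * t) * E t) (Real.exp (c * t) * (c * E t + E' t)) t := by
    intro c t ht
    have h1 : HasDerivAt (fun t => Real.exp (c * t)) (Real.exp (c * t) * c) t := by
      simpa using ((hasDerivAt_id t).const_mul c).exp
    exact (h1.mul (hd t ht)).congr_deriv (by ring)
  have hcont : ∀ c : ℝ, ContinuousOn (fun t => Real.exp (c * t) * E t) (Set.uIcc 0 T) := fun c =>
    (Continuous.continuousOn (by fun_prop)).mul hc
  apply le_antisymm _ hT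
  rcases le_total 0 T with h | h
  · have := antitoneOn_of_deriv_nonpos (convex_uIcc 0 T) (hcont (-M))
      (fun t ht => (hder _ t ht).differentiableAt.differentiableWithinAt) (fun t ht => by
        rw [(hder _ t ht).deriv]
        refine mul_nonpos_of_nonneg_of_nonpos (Real.exp_pos _).le ?_
        linarith [(abs_le.1 (hb t ht)).2]) Set.left_mem_uIcc Set.right_mem_uIcc h
    simp only [h0, mul_zero] at this
    exact nonpos_of_mul_nonpos_right this (Real.exp_pos _)
  · have := monotoneOn_of_deriv_nonneg (convex_uIcc 0 T) (hcont M)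
      (fun t ht => (hder _ t ht).differentiableAt.differentiableWithinAt) (fun t ht => by
        rw [(hder _ t ht).deriv]
        refine mul_nonneg (Real.exp_pos _).le ?_
        linarith [(abs_le.1 (hb t ht)).1]) Set.right_mem_uIcc Set.left_mem_uIcc h
    simp only [h0, mul_zero] at this
    exact nonpos_of_mul_nonpos_right this (Real.exp_pos _)

end Gronwall

section ParametricIntegral

variable {d : ℕ} {I : Set ℝ} {F : ℝ → Space d → ℝ}

theorem continuousOn_integral_cube (hI : IsCompact I)
    (hF : ContinuousOn (fun z : ℝ × Space d => F z.1 z.2) (I ×ˢ Set.univ)) :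
    ContinuousOn (fun t => ∫ y in cube d, F t (WithLp.toLp 2 y)) I := by
  have hF' : ContinuousOn (fun z : ℝ × (Fin d → ℝ) => F z.1 (WithLp.toLp 2 z.2))
      (I ×ˢ Set.univ) :=
    hF.comp (f := fun z : ℝ × (Fin d → ℝ) => (z.1, (WithLp.toLp 2 z.2 : Space d)))
      (continuous_fst.prodMk (continuous_toLp.comp continuous_snd)).continuousOn
      (fun z hz => ⟨hz.1, trivial⟩)
  obtain ⟨C, hC⟩ := (hI.prod (isCompact_Icc : IsCompact (cube d))).exists_bound_of_continuousOn
    (hF'.mono (Set.prod_mono_right (Set.subset_univ _)))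
  refine continuousOn_of_dominated (bound := fun _ => C) (fun t ht => ?_) (fun t ht => ?_)
    (integrable_const C) ?_
  · refine Continuous.aestronglyMeasurable ?_
    exact hF'.comp_continuous (continuous_const.prodMk continuous_id) fun y => ⟨ht, trivial⟩
  · exact (ae_restrict_iff' measurableSet_Icc).2 (Eventually.of_forall fun y hy => hC (t, y) ⟨ht, hy⟩)
  · exact Eventually.of_forall fun y => hF'.comp (continuous_id.prodMk continuous_const).continuousOn
      fun t ht => ⟨ht, trivial⟩

theorem hasDerivAt_integral_cube
    (hF : ContDiffOn ℝ ∞ (fun z : ℝ × Space d => F z.1 z.2) (I ×ˢ Set.univ)) {t : ℝ}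
    (ht : t ∈ interior I) :
    HasDerivAt (fun t => ∫ y in cube d, F t (WithLp.toLp 2 y))
      (∫ y in cube d, deriv (fun s => F s (WithLp.toLp 2 y)) t) t := by
  set G : ℝ × Space d → ℝ := fun z => F z.1 z.2 with hG
  have hopen : IsOpen (interior I ×ˢ (Set.univ : Set (Space d))) := isOpen_interior.prod isOpen_univ
  have hF1 : ContDiffOn ℝ ∞ G (interior I ×ˢ Set.univ) :=
    hF.mono (Set.prod_mono_left interior_subset)
  have hder : ∀ s ∈ interior I, ∀ x : Space d,
      HasDerivAt (fun s => F s x) (fderiv ℝ G (s, x) (1, 0)) s := by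
    intro s hs x
    have h1 : DifferentiableAt ℝ G (s, x) :=
      (hF1.contDiffAt (hopen.mem_nhds ⟨hs, trivial⟩)).differentiableAt (by simp)
    have h2 : HasDerivAt (fun s : ℝ => (s, x)) (1, 0) s :=
      (hasDerivAt_id s).prodMk (hasDerivAt_const s x)
    exact h1.hasFDerivAt.comp_hasDerivAt s h2
  have hcont' : ContinuousOn (fun z => fderiv ℝ G z (1, 0)) (interior I ×ˢ Set.univ) :=
    (hF1.continuousOn_fderiv_of_isOpen hopen (by simp)).clm_apply continuousOn_const
  have hmap : Continuous fun z : ℝ × (Fin d → ℝ) => (z.1, (WithLp.toLp 2 z.2 : Space d)) :=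
    continuous_fst.prodMk (continuous_toLp.comp continuous_snd)
  have hslice : ∀ s : ℝ, Continuous fun y : Fin d → ℝ => (s, (WithLp.toLp 2 y : Space d)) :=
    fun s => continuous_const.prodMk continuous_toLp
  obtain ⟨r, hr, hball⟩ := Metric.nhds_basis_closedBall.mem_iff.1 (isOpen_interior.mem_nhds ht)
  obtain ⟨C, hC⟩ := ((isCompact_closedBall t r).prod
    (isCompact_Icc : IsCompact (cube d))).exists_bound_of_continuousOn
    (hcont'.comp hmap.continuousOn fun z hz => ⟨hball hz.1, trivial⟩)
  have hsm : ∀ s ∈ interior I, Continuous fun y : Fin d → ℝ => F s (WithLp.toLp 2 y) := fun s hs =>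
    hF1.continuousOn.comp_continuous (hslice s) fun y => ⟨hs, trivial⟩
  have key := hasDerivAt_integral_of_dominated_loc_of_deriv_le
    (μ := volume.restrict (cube d)) (F := fun s y => F s (WithLp.toLp 2 y))
    (F' := fun s y => fderiv ℝ G (s, WithLp.toLp 2 y) (1, 0)) (bound := fun _ => C)
    (Metric.closedBall_mem_nhds t hr)
    (by
      filter_upwards [isOpen_interior.mem_nhds ht] with s hs
      exact (hsm s hs).aestronglyMeasurable)
    ((hsm t ht).continuousOn.integrableOn_compact isCompact_Icc)
    (hcont'.comp_continuous (hslice t) fun y => ⟨ht, trivial⟩).aestronglyMeasurable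
    ((ae_restrict_iff' measurableSet_Icc).2
      (Eventually.of_forall fun y hy s hs => hC (s, y) ⟨hs, hy⟩))
    (integrable_const C)
    (Eventually.of_forall fun y s hs => hder s (hball hs) _)
  refine key.2.congr_deriv ?_
  exact congrArg _ (funext fun y => ((hder t ht _).deriv).symm)

end ParametricIntegral

end EulerTorus

/-! ### Uniqueness for the Euler equations. -/

namespace EulerTorus

open MeasureTheory
open scoped RealInnerProductSpace

section Uniqueness

theorem SVect.differentiable_lift {d : ℕ} (u : SVect d) : Differentiable ℝ u.lift :=
  u.contDiff_lift.differentiable (by simp)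

theorem SVect.continuous_fderiv_lift {d : ℕ} (u : SVect d) : Continuous (fderiv ℝ u.lift) :=
  u.contDiff_lift.continuous_fderiv (by simp)

theorem SVect.fderiv_lift_sub {d : ℕ} (u v : SVect d) (x : Space d) :
    fderiv ℝ (u - v).lift x = fderiv ℝ u.lift x - fderiv ℝ v.lift x :=
  fderiv_sub (u.differentiable_lift x) (v.differentiable_lift x)

/-- With `δ = w - u`, the difference of the nonlinearities is `w·∇δ + δ·∇u`. Since `w` and `δ` are
divergence-free, `⟪δ, w·∇δ⟫ + ⟪δ, ∇q⟫` is the divergence of the periodic field `½|δ|² w + q δ` and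
integrates to zero. -/
theorem integral_inner_sub_eq {n : ℕ} (u w : SVect (n + 1)) {q : Space (n + 1) → ℝ}
    (hq : ContDiff ℝ ∞ q) (hqp : IsPeriodic q) :
    ∫ y in cube (n + 1), ⟪(w - u).lift (WithLp.toLp 2 y),
      -(fderiv ℝ w.lift (WithLp.toLp 2 y) (w.lift (WithLp.toLp 2 y)) -
        fderiv ℝ u.lift (WithLp.toLp 2 y) (u.lift (WithLp.toLp 2 y))) -
        gradient q (WithLp.toLp 2 y)⟫ =
    -∫ y in cube (n + 1), ⟪(w - u).lift (WithLp.toLp 2 y),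
      fderiv ℝ u.lift (WithLp.toLp 2 y) ((w - u).lift (WithLp.toLp 2 y))⟫ := by
  set δ := w - u with hδ
  set φ : Space (n + 1) → ℝ := fun x => 2⁻¹ * ‖δ.lift x‖ ^ 2 with hφ
  have hφs : ContDiff ℝ ∞ φ := contDiff_const.mul (δ.contDiff_lift.norm_sq ℝ)
  set X : Space (n + 1) → Space (n + 1) := fun x => φ x • w.lift x + q x • δ.lift x with hX
  have hXs : ContDiff ℝ ∞ X := (hφs.smul w.contDiff_lift).add (hq.smul δ.contDiff_lift)
  have hXp : IsPeriodic X := by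
    intro x y h
    simp only [hX, hφ, δ.isPeriodic_lift h, w.isPeriodic_lift h, hqp h]
  have hdiv : ∀ x, divergence X x = ⟪δ.lift x, fderiv ℝ δ.lift x (w.lift x)⟫ +
      ⟪δ.lift x, gradient q x⟫ := by
    intro x
    have hφd : DifferentiableAt ℝ φ x := hφs.differentiable (by simp) x
    have hqd : DifferentiableAt ℝ q x := hq.differentiable (by simp) x
    rw [hX, divergence_add (hφd.fun_smul (w.differentiable_lift x))
      (hqd.fun_smul (δ.differentiable_lift x)), divergence_smul hφd (w.differentiable_lift x),
      divergence_smul hqd (δ.differentiable_lift x), w.divergence_lift, δ.divergence_lift]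
    have h1 : fderiv ℝ φ x (w.lift x) = ⟪δ.lift x, fderiv ℝ δ.lift x (w.lift x)⟫ := by
      have h' : HasFDerivAt φ _ x :=
        ((δ.differentiable_lift x).hasFDerivAt.norm_sq).const_mul (2⁻¹ : ℝ)
      rw [h'.fderiv]
      simp
    rw [h1, real_inner_comm (gradient q x), inner_gradient_left]
    ring
  have hcont : Continuous fun y : Fin (n + 1) → ℝ => ⟪δ.lift (WithLp.toLp 2 y),
      fderiv ℝ u.lift (WithLp.toLp 2 y) (δ.lift (WithLp.toLp 2 y))⟫ := by
    have : Continuous fun x => ⟪δ.lift x, fderiv ℝ u.lift x (δ.lift x)⟫ :=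
      δ.contDiff_lift.continuous.inner
        (u.continuous_fderiv_lift.clm_apply δ.contDiff_lift.continuous)
    exact this.comp continuous_toLp
  have hcontX : Continuous fun y : Fin (n + 1) → ℝ => divergence X (WithLp.toLp 2 y) := by
    have : Continuous (divergence X) := continuous_finsetSum _ fun i _ =>
      (contDiff_coord i).continuous.comp
        ((hXs.continuous_fderiv (by simp)).clm_apply continuous_const)
    exact this.comp continuous_toLp
  have hint := integral_divergence_eq_zero (hXs.of_le (by exact_mod_cast le_top)) hXp
  have hsub := integral_sub (μ := volume.restrict (cube (n + 1)))
    (hcont.fun_neg.continuousOn.integrableOn_compact isCompact_Icc)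
    (hcontX.continuousOn.integrableOn_compact isCompact_Icc)
  rw [hint, sub_zero, integral_neg] at hsub
  rw [← hsub]
  refine congrArg _ (funext fun y => ?_)
  rw [hdiv, hδ, SVect.fderiv_lift_sub, SVect.lift_sub]
  simp only [Pi.sub_apply, _root_.sub_apply, map_sub, inner_sub_right, inner_neg_right]
  ring

/-- The energy `E t = ∫ |w - v|²` satisfies `|E'| ≤ 2 M E`, where `M` bounds `∇v` on the compact
time interval between `0` and `T`. Only the global solution `v` enters the bound, and derivatives
are needed only at interior times, so one-sided endpoints cause no trouble. -/
theorem euler_unique {n : ℕ} {I : Set ℝ} (hI : I.OrdConnected) (h0 : 0 ∈ I)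
    {v w : ℝ → SVect (n + 1)} (hv : IsEulerSolutionOn Set.univ v) (hw : IsEulerSolutionOn I w)
    (hvw : w 0 = v 0) {T : ℝ} (hT : T ∈ I) : w T = v T := by
  obtain ⟨hvs, p, hps, hpe⟩ := hv
  obtain ⟨hws, q, hqs, hqe⟩ := hw
  rw [Set.univ_prod_univ, contDiffOn_univ] at hvs hps
  set J := Set.uIcc 0 T with hJ
  have hJI : J ⊆ I := hI.uIcc_subset h0 hT
  set F : ℝ → Space (n + 1) → ℝ := fun t x => ‖(w t - v t).lift x‖ ^ 2 with hF
  have hFs : ContDiffOn ℝ ∞ (fun z : ℝ × Space (n + 1) => F z.1 z.2) (J ×ˢ Set.univ) :=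
    ((hws.mono (Set.prod_mono_left hJI)).sub hvs.contDiffOn).norm_sq ℝ
  set E : ℝ → ℝ := fun t => ∫ y in cube (n + 1), F t (WithLp.toLp 2 y) with hE
  have hvf : Continuous fun z : ℝ × Space (n + 1) => fderiv ℝ (v z.1).lift z.2 :=
    (ContDiff.fderiv (n := 0) (m := ∞) (f := fun (z : ℝ × Space (n + 1)) y => (v z.1).lift y)
      (hvs.comp ((contDiff_fst.comp contDiff_fst).prodMk contDiff_snd)) contDiff_snd
      (by simp)).continuous
  obtain ⟨M, hM⟩ := ((isCompact_uIcc : IsCompact J).prod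
    (isCompact_Icc : IsCompact (cube (n + 1)))).exists_bound_of_continuousOn
    (hvf.comp (continuous_fst.prodMk (continuous_toLp.comp continuous_snd))).continuousOn
  have hFc : ∀ t ∈ J, Continuous fun y : Fin (n + 1) → ℝ => F t (WithLp.toLp 2 y) := fun t _ =>
    ((((w t - v t).contDiff_lift.norm_sq ℝ).continuous).comp continuous_toLp)
  have hder : ∀ t ∈ interior J, ∀ x, deriv (fun s => F s x) t = 2 * ⟪(w t - v t).lift x,
      -(fderiv ℝ (w t).lift x ((w t).lift x) - fderiv ℝ (v t).lift x ((v t).lift x)) -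
        gradient (fun x => q t (proj x) - p t (proj x)) x⟫ := by
    intro t ht x
    have htI : I ∈ 𝓝 t := mem_interior_iff_mem_nhds.1 (interior_mono hJI ht)
    have htI' : t ∈ I := mem_of_mem_nhds htI
    have hline : ContDiff ℝ ∞ fun s : ℝ => (s, x) := contDiff_id.prodMk contDiff_const
    have hwa := hws.contDiffAt (x := (t, x)) (prod_mem_nhds htI univ_mem)
    have hwd : DifferentiableAt ℝ (fun s => (w s).lift x) t :=
      (ContDiffAt.comp (f := fun s : ℝ => (s, x)) t hwa
        hline.contDiffAt).differentiableAt (by simp)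
    have hvd : DifferentiableAt ℝ (fun s => (v s).lift x) t :=
      (hvs.comp hline).differentiable (by simp) t
    have hslice : ContDiff ℝ ∞ fun y : Space (n + 1) => (t, y) := contDiff_const.prodMk contDiff_id
    have hqd : DifferentiableAt ℝ (fun y => q t (proj y)) x :=
      (contDiffOn_univ.1 (hqs.comp hslice.contDiffOn
        fun y _ => ⟨htI', trivial⟩)).differentiable (by simp) x
    have hpd : DifferentiableAt ℝ (fun y => p t (proj y)) x :=
      (hps.comp hslice).differentiable (by simp) x
    have ew := hqe t htI' x
    have ev := hpe t trivial x
    rw [derivWithin_of_mem_nhds htI] at ew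
    rw [derivWithin_univ] at ev
    have hgrad : gradient (fun x => q t (proj x) - p t (proj x)) x =
        gradient (fun y => q t (proj y)) x - gradient (fun y => p t (proj y)) x := by
      rw [gradient, fderiv_fun_sub hqd hpd, map_sub]; rfl
    have hd : HasDerivAt (fun s => (w s - v s).lift x)
        (deriv (fun s => (w s).lift x) t - deriv (fun s => (v s).lift x) t) t :=
      hwd.hasDerivAt.sub hvd.hasDerivAt
    rw [hF, hd.norm_sq.deriv, hgrad]
    congr 2
    rw [add_assoc] at ew ev
    rw [eq_neg_of_add_eq_zero_left ew, eq_neg_of_add_eq_zero_left ev]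
    abel
  have hEd : ∀ t ∈ interior J, HasDerivAt E (-(2 * ∫ y in cube (n + 1),
      ⟪(w t - v t).lift (WithLp.toLp 2 y),
        fderiv ℝ (v t).lift (WithLp.toLp 2 y) ((w t - v t).lift (WithLp.toLp 2 y))⟫)) t := by
    intro t ht
    refine (hasDerivAt_integral_cube hFs ht).congr_deriv ?_
    have htI : t ∈ I := hJI (interior_subset ht)
    have hslice : ContDiff ℝ ∞ fun y : Space (n + 1) => (t, y) := contDiff_const.prodMk contDiff_id
    have hqs' : ContDiff ℝ ∞ fun x => q t (proj x) - p t (proj x) :=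
      (contDiffOn_univ.1 (hqs.comp hslice.contDiffOn fun y _ => ⟨htI, trivial⟩)).sub
        (hps.comp hslice)
    simp only [hder t ht]
    rw [integral_const_mul, integral_inner_sub_eq (v t) (w t) hqs' fun x y h => by simp only [h]]
    ring
  have hEb : ∀ t ∈ interior J, |-(2 * ∫ y in cube (n + 1), ⟪(w t - v t).lift (WithLp.toLp 2 y),
      fderiv ℝ (v t).lift (WithLp.toLp 2 y) ((w t - v t).lift (WithLp.toLp 2 y))⟫)| ≤
      2 * M * E t := by
    intro t ht
    have htJ := interior_subset ht
    rw [abs_neg, abs_mul, abs_two, mul_assoc]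
    refine mul_le_mul_of_nonneg_left ?_ zero_le_two
    rw [← integral_const_mul, ← Real.norm_eq_abs]
    refine norm_integral_le_of_norm_le
      (((hFc t htJ).const_mul M).continuousOn.integrableOn_compact isCompact_Icc) ?_
    refine (ae_restrict_iff' measurableSet_Icc).2 (Eventually.of_forall fun y hy => ?_)
    refine (norm_inner_le_norm _ _).trans ?_
    have h1 := (fderiv ℝ (v t).lift (WithLp.toLp 2 y)).le_opNorm
      ((w t - v t).lift (WithLp.toLp 2 y))
    have h2 : ‖fderiv ℝ (v t).lift (WithLp.toLp 2 y)‖ ≤ M := hM (t, y) ⟨htJ, hy⟩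
    calc _ ≤ ‖(w t - v t).lift (WithLp.toLp 2 y)‖ *
          (M * ‖(w t - v t).lift (WithLp.toLp 2 y)‖) := by gcongr; exact h1.trans (by gcongr)
      _ = M * F t (WithLp.toLp 2 y) := by simp only [hF]; ring
  have hE0 : E 0 = 0 := by
    simp only [hE, hF, hvw, sub_self]
    simp [SVect.lift_zero]
  have hTJ : T ∈ J := Set.right_mem_uIcc
  have hET : E T = 0 := eq_zero_of_abs_deriv_le
    (continuousOn_integral_cube isCompact_uIcc hFs.continuousOn) hEd hEb hE0
    (integral_nonneg fun y => sq_nonneg _)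
  have hae := (setIntegral_eq_zero_iff_of_nonneg_ae (Eventually.of_forall fun y => sq_nonneg _)
    ((hFc T hTJ).continuousOn.integrableOn_compact isCompact_Icc)).1 hET
  -- Vanishing almost everywhere becomes vanishing everywhere for a continuous function on a set
  -- contained in the closure of its interior.
  have hcl : cube (n + 1) ⊆ closure (interior (cube (n + 1))) := by
    rw [cube, ← Set.pi_univ_Icc, interior_pi_set Set.finite_univ, closure_pi_set]
    simp [interior_Icc, closure_Ioo Real.two_pi_pos.ne]
  have heq := Measure.eqOn_of_ae_eq hae (hFc T hTJ).continuousOn continuousOn_const hcl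
  apply Subtype.ext
  ext1 Z
  obtain ⟨z, rfl, hz⟩ := exists_proj_eq Z
  have h1 : F T z = 0 := heq (x := z) ⟨fun i => (hz i).1, fun i => (hz i).2⟩
  have h2 : (w T).lift z - (v T).lift z = 0 := by
    simpa [hF, SVect.lift_sub] using h1
  exact sub_eq_zero.1 h2

end Uniqueness

end EulerTorus

/-! ### Families of translates, and the nonlinearity of a shear with vortices. -/

namespace EulerTorus

section TranslationFamily

variable {d N : ℕ}

/-- The field `C + ∑ⱼ Vⱼ(· - θⱼ eₐ)`. -/
def translationFamily (a : Fin d) (C : SVect d) (V : Fin N → SVect d) (θ : Torus N) : SVect d :=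
  C + ∑ j, SVect.translate (Pi.single a (-θ j)) (V j)

theorem continuous_translationFamily (a : Fin d) (C : SVect d) (V : Fin N → SVect d) :
    Continuous (translationFamily a C V) := by
  refine continuous_const.add (continuous_finsetSum _ fun j _ => ?_)
  exact (SVect.continuous_translate (V j)).comp
    ((continuous_single a).comp (continuous_apply j).neg)

theorem single_neg_eq_proj (a : Fin d) (s : ℝ) :
    (Pi.single a (-(s : AddCircle (2 * Real.pi))) : Torus d) =
      proj (-s • EuclideanSpace.single a (1 : ℝ)) := by
  rw [proj_smul_single, AddCircle.coe_neg]

/-- The derivative is again a family of translates, with constant part `0` and differentiated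
profiles; so one induction gives every order of smoothness. -/
theorem hasDirDeriv_translationFamily (a : Fin d) (C : SVect d) (V : Fin N → SVect d)
    (x h : Space N) :
    HasDirDeriv (fun x : Space N => translationFamily a C V (proj x)) x h
      (translationFamily a 0
        (fun j => SVect.dirDeriv (-h j • EuclideanSpace.single a (1 : ℝ)) (V j)) (proj x)) := by
  have key := tendsto_finsetSum (Finset.univ : Finset (Fin N)) fun j _ =>
    SVect.tendsto_slope_translate (V j) (-x j • EuclideanSpace.single a (1 : ℝ))
      (-h j • EuclideanSpace.single a (1 : ℝ))
  unfold HasDirDeriv translationFamily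
  rw [zero_add]
  simp only [proj, single_neg_eq_proj]
  refine key.congr fun s => ?_
  rw [← Finset.smul_sum, add_sub_add_left_eq_sub, Finset.sum_sub_distrib]
  congr 3
  ext1 j
  congr 2
  rw [PiLp.add_apply, PiLp.smul_apply, smul_eq_mul]
  module

theorem isCk_translationFamily (a : Fin d) (k : ℕ) (C : SVect d) (V : Fin N → SVect d) :
    IsCk k fun x : Space N => translationFamily a C V (proj x) := by
  induction k generalizing C V with
  | zero => exact (continuous_translationFamily a C V).comp isOpenQuotientMap_proj.continuous
  | succ k ih =>
    exact ⟨(continuous_translationFamily a C V).comp isOpenQuotientMap_proj.continuous, _,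
      fun i x => hasDirDeriv_translationFamily a C V x (EuclideanSpace.single i 1),
      fun i => ih _ _⟩

end TranslationFamily

section ShearWithVortices

variable {d : ℕ} {ι : Type*} [Fintype ι] {a l : Fin d} {ε : ℝ}

theorem gradient_sum {q : ι → Space d → ℝ} {x : Space d}
    (hq : ∀ i, DifferentiableAt ℝ (q i) x) :
    gradient (fun y => ∑ i, q i y) x = ∑ i, gradient (q i) x := by
  rw [gradient, fderiv_fun_sum fun i _ => hq i, map_sum]
  rfl

/-- A shear flow which is constant on pairwise disjoint strips, with a vortex in each strip: the
nonlinearity of the Euler equations acts by transporting each vortex with the local speed. -/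
theorem fderiv_shear_add_vortices (hal : a ≠ l) (hε : 0 < ε) (hε' : ε < Real.pi) {ax : ι → Fin d}
    (hax : ∀ i, ax i ≠ l) (c : ι → Torus d) (hsep : ∀ i j, i ≠ j → 2 * ε ≤ ‖c i l - c j l‖)
    {f : AddCircle (2 * Real.pi) → ℝ} (hf : ContDiff ℝ ∞ fun x : ℝ => f x) {μ : ι → ℝ}
    (hfc : ∀ i Y, ‖Y - c i l‖ ≤ ε → f Y = μ i) (x : Space d) :
    fderiv ℝ (shear hal f hf + ∑ i, vortex (hax i) hε hε' (c i)).lift x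
        ((shear hal f hf + ∑ i, vortex (hax i) hε hε' (c i)).lift x) +
      gradient (fun y => ∑ i, vortexPressure (ax i) l ε (c i) (proj y)) x =
    ∑ i, μ i • fderiv ℝ (vortex (hax i) hε hε' (c i)).lift x (EuclideanSpace.single a 1) := by
  set S := shear hal f hf
  set W : ι → SVect d := fun i => vortex (hax i) hε hε' (c i) with hW
  have hfd : fderiv ℝ (S + ∑ i, W i).lift x =
      fderiv ℝ S.lift x + ∑ i, fderiv ℝ (W i).lift x := by
    rw [SVect.lift_add, SVect.lift_sum, fderiv_add (S.differentiable_lift x)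
      (DifferentiableAt.sum fun i _ => (W i).differentiable_lift x),
      fderiv_sum fun i _ => (W i).differentiable_lift x]
  have hval : (S + ∑ i, W i).lift x = S.lift x + ∑ i, (W i).lift x := by
    rw [SVect.lift_add, SVect.lift_sum, Pi.add_apply, Finset.sum_apply]
  have hSS : fderiv ℝ S.lift x (S.lift x) = 0 := by
    rw [fderiv_shear_lift, shear_lift]
    simp [hal.symm]
  -- Where the vortex is nonzero, the shear is locally constant.
  have hSW : ∀ i, fderiv ℝ S.lift x ((W i).lift x) = 0 := by
    intro i
    rcases le_or_gt ε ‖proj x l - c i l‖ with h | h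
    · rw [hW, vortex_lift_eq_zero _ _ _ _ h, map_zero]
    · have hc : Continuous fun s : ℝ => ‖(s : AddCircle (2 * Real.pi)) - c i l‖ :=
        ((AddCircle.continuous_mk' _).sub continuous_const).norm
      have : (fun s : ℝ => f s) =ᶠ[𝓝 (x l)] fun _ => μ i := by
        filter_upwards [hc.continuousAt.eventually_lt continuousAt_const h] with s hs
        exact hfc i s hs.le
      rw [fderiv_shear_lift, this.deriv_eq]
      simp
  -- The shear is `μ i e_a` on the closed strip, and the vortex has zero derivative off it.
  have hWS : ∀ i, fderiv ℝ (W i).lift x (S.lift x) =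
      μ i • fderiv ℝ (W i).lift x (EuclideanSpace.single a 1) := by
    intro i
    rcases le_or_gt ‖proj x l - c i l‖ ε with h | h
    · rw [shear_lift, map_smul, hfc i _ h]
    · rw [hW, fderiv_vortex_lift_eq_zero _ _ _ _ h]
      simp
  -- Cross terms vanish because the strips are separated; the self-interaction is balanced by the
  -- pressure of the vortex.
  have hWW : ∀ i, fderiv ℝ (W i).lift x (∑ j, (W j).lift x) =
      -gradient (fun y => vortexPressure (ax i) l ε (c i) (proj y)) x := by
    intro i
    rw [map_sum, Finset.sum_eq_single i, ← add_eq_zero_iff_eq_neg]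
    · exact euler_vortex (hax i) hε hε' (c i) x
    · intro j _ hji
      rcases le_or_gt ε ‖proj x l - c j l‖ with h | h
      · rw [hW, vortex_lift_eq_zero _ _ _ _ h, map_zero]
      · have h2 : ε < ‖proj x l - c i l‖ := by
          have h3 := hsep j i hji
          have h4 := norm_sub_le (proj x l - c i l) (proj x l - c j l)
          rw [sub_sub_sub_cancel_left] at h4
          linarith
        rw [hW, fderiv_vortex_lift_eq_zero _ _ _ _ h2]
        simp
    · simp
  rw [hfd, hval, gradient_sum fun i =>
    (contDiff_vortexPressure (hax i) hε hε' (c i)).differentiable (by simp) x]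
  simp only [_root_.add_apply, map_add, hSS, FunLike.coe_sum, Finset.sum_apply, hWS]
  rw [map_sum, Finset.sum_eq_zero fun i _ => hSW i]
  simp only [hWW, Finset.sum_neg_distrib]
  abel

end ShearWithVortices

end EulerTorus

/-! ### The quasi-periodic family and its properties. -/

namespace EulerTorus

section Heights

instance : Infinite (AddCircle (2 * Real.pi)) :=
  (AddCircle.equivIco (2 * Real.pi) 0).infinite_iff.2
    (Set.Ico_infinite (by linarith [Real.two_pi_pos])).to_subtype

/-- A finite set of points in the infinite circle has a positive minimal distance. The gap `4 * ε`
keeps the strip of radius `ε` about one height away from the plateau supports of radius `2 * ε`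
about the others. -/
theorem exists_separated_heights (ι : Type*) [Finite ι] : ∃ ε : ℝ, 0 < ε ∧ 2 * ε < Real.pi ∧
    ∃ h : ι → AddCircle (2 * Real.pi), ∀ i j, i ≠ j → 4 * ε ≤ ‖h i - h j‖ := by
  classical
  cases nonempty_fintype ι
  obtain ⟨h⟩ : Nonempty (ι ↪ AddCircle (2 * Real.pi)) :=
    ⟨(Fintype.equivFin ι).toEmbedding.trans (Fin.valEmbedding.trans (Infinite.natEmbedding _))⟩
  have hpos : ∀ p : ι × ι, 0 < if p.1 = p.2 then 1 else ‖h p.1 - h p.2‖ := by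
    intro p
    split_ifs with hp
    · exact one_pos
    · exact norm_pos_iff.2 (sub_ne_zero.2 fun e => hp (h.injective e))
  obtain ⟨r, hr', hr⟩ := ((eventually_all.2 fun p => Iio_mem_nhds (hpos p)).filter_mono
    nhdsWithin_le_nhds |>.and self_mem_nhdsWithin : ∀ᶠ r in 𝓝[>] (0 : ℝ), _).exists
  replace hr : 0 < r := hr
  -- The cap `1` gives `2 * ε ≤ 2 < π`.
  refine ⟨min (r / 4) 1, by positivity, ?_, h, fun i j hij => ?_⟩
  · linarith [min_le_right (r / 4) 1, Real.pi_gt_three]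
  · have : r < _ := hr' (i, j)
    rw [if_neg hij] at this
    linarith [min_le_left (r / 4) 1]

end Heights

section Construction

variable {n N : ℕ}

/-- The vortices: a moving one for every frequency, and a fixed one for every coordinate plane
containing the coordinate `1`. -/
abbrev VortexIndex (n N : ℕ) : Type := Fin N ⊕ {k : Fin (n + 2) // k ≠ 1}

/-- The coordinate that spans, with the coordinate `1`, the plane of a vortex. -/
def axis : VortexIndex n N → Fin (n + 2) := Sum.elim (fun _ => 0) Subtype.val

theorem axis_ne_one (i : VortexIndex n N) : axis i ≠ 1 := by
  rcases i with j | k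
  · exact zero_ne_one
  · exact k.2

/-- The centre of a vortex in the configuration `θ`, the heights being `h`. -/
def centre (h : VortexIndex n N → AddCircle (2 * Real.pi)) (θ : Torus N) (i : VortexIndex n N) :
    Torus (n + 2) :=
  Pi.single 1 (h i) + Pi.single 0 (Sum.elim θ (fun _ => 0) i)

variable {h : VortexIndex n N → AddCircle (2 * Real.pi)}

theorem centre_apply_one (θ : Torus N) (i : VortexIndex n N) : centre h θ i 1 = h i := by
  simp [centre]

theorem centre_inl_zero (θ : Torus N) (j : Fin N) : centre h θ (.inl j) 0 = θ j := by
  simp [centre]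

theorem centre_inr_axis (θ : Torus N) (k : {k : Fin (n + 2) // k ≠ 1}) :
    centre h θ (.inr k) k = 0 := by
  simp [centre, k.2]

theorem centre_eq_sub (θ : Torus N) (i : VortexIndex n N) :
    centre h θ i = centre h 0 i - Pi.single 0 (-Sum.elim θ (fun _ => 0) i) := by
  rcases i with j | k <;> simp [centre, Pi.single_neg]

variable {ε : ℝ} (hε : 0 < ε) (hε' : 2 * ε < Real.pi) (h) (ν : Space N)

/-- The speed of the background shear flow, equal to `ν j` in the strip of the `j`-th moving
vortex and to `0` in the strips of the fixed vortices. -/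
def velocityProfile (h : VortexIndex n N → AddCircle (2 * Real.pi)) (ε : ℝ) (ν : Space N)
    (Y : AddCircle (2 * Real.pi)) : ℝ :=
  ∑ j, ν j * plateau ε (Y - h (.inl j))

include hε hε' in
theorem contDiff_velocityProfile : ContDiff ℝ ∞ fun x : ℝ => velocityProfile h ε ν x :=
  ContDiff.sum fun _ _ => contDiff_const.mul (contDiff_plateau hε hε' _)

theorem lt_pi (hε : 0 < ε) (hε' : 2 * ε < Real.pi) : ε < Real.pi := by linarith

/-- The background shear flow. -/
def background : SVect (n + 2) :=
  shear (zero_ne_one : (0 : Fin (n + 2)) ≠ 1) (velocityProfile h ε ν)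
    (contDiff_velocityProfile h hε hε' ν)

/-- The quasi-periodic family: the background shear flow with all the vortices. -/
def flow (θ : Torus N) : SVect (n + 2) :=
  background h hε hε' ν +
    ∑ i, vortex (axis_ne_one i) hε (lt_pi hε hε') (centre h θ i)

/-- Only the moving vortices depend on `θ`, each through its translation along coordinate `0`. -/
theorem flow_eq_translationFamily :
    flow h hε hε' ν = translationFamily 0 (background h hε hε' ν +
        ∑ k, vortex (axis_ne_one (.inr k : VortexIndex n N)) hε (lt_pi hε hε') (centre h 0 (.inr k)))
      (fun j => vortex (axis_ne_one (.inl j)) hε (lt_pi hε hε') (centre h 0 (.inl j))) := by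
  ext1 θ
  rw [flow, translationFamily, Fintype.sum_sum_type, add_assoc, add_comm (∑ j : Fin N, _)]
  refine congrArg₂ (· + ·) rfl (congrArg₂ (· + ·) ?_ ?_)
  · refine Finset.sum_congr rfl fun k _ => ?_
    congr 1
  · refine Finset.sum_congr rfl fun j _ => ?_
    rw [vortex_translate, centre_eq_sub]
    rfl

variable {h} (hsep : ∀ i j, i ≠ j → 4 * ε ≤ ‖h i - h j‖)

include hε hsep in
theorem velocityProfile_eq (i : VortexIndex n N) {Y : AddCircle (2 * Real.pi)}
    (hY : ‖Y - h i‖ ≤ ε) :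
    velocityProfile h ε ν Y = Sum.elim ν (fun _ => 0) i := by
  unfold velocityProfile
  have hfar : ∀ j : Fin N, .inl j ≠ i → plateau ε (Y - h (.inl j)) = 0 := by
    intro j hj
    apply plateau_eq_zero hε
    have h1 := hsep _ _ hj
    have h2 := norm_sub_le (Y - h i) (Y - h (.inl j))
    rw [sub_sub_sub_cancel_left] at h2
    linarith
  rcases i with j | k
  · rw [Finset.sum_eq_single j]
    · rw [plateau_eq_one hε hY, mul_one]
      rfl
    · intro j' _ hj'
      rw [hfar j' (by simpa using hj'), mul_zero]
    · simp
  · refine Finset.sum_eq_zero fun j _ => ?_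
    rw [hfar j (by simp), mul_zero]

include hsep in
theorem vortex_lift_eq_zero_of_ne {i j : VortexIndex n N} (hij : j ≠ i) (θ : Torus N)
    {x : Space (n + 2)} (hx : ‖proj x 1 - h i‖ ≤ ε) :
    (vortex (axis_ne_one j) hε (lt_pi hε hε') (centre h θ j)).lift x = 0 ∧
      fderiv ℝ (vortex (axis_ne_one j) hε (lt_pi hε hε') (centre h θ j)).lift x = 0 := by
  have h1 := hsep j i hij
  have h2 := norm_sub_le (proj x 1 - h i) (proj x 1 - h j)
  rw [sub_sub_sub_cancel_left] at h2
  have h3 : ε < ‖proj x 1 - centre h θ j 1‖ := by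
    rw [centre_apply_one]
    linarith
  exact ⟨vortex_lift_eq_zero _ _ _ _ h3.le, fderiv_vortex_lift_eq_zero _ _ _ _ h3⟩

include hsep in
theorem flow_lift_of_strip (i : VortexIndex n N) (θ : Torus N) {x : Space (n + 2)}
    (hx : ‖proj x 1 - h i‖ ≤ ε) :
    (flow h hε hε' ν θ).lift x = (background h hε hε' ν).lift x +
      vortexField (axis i) 1 ε (centre h θ i) (proj x) := by
  rw [flow, SVect.lift_add, SVect.lift_sum, Pi.add_apply, Finset.sum_apply,
    Finset.sum_eq_single i]
  · rfl
  · intro j _ hj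
    exact (vortex_lift_eq_zero_of_ne hε hε' hsep hj θ hx).1
  · simp

theorem background_lift_one (x : Space (n + 2)) : (background h hε hε' ν).lift x 1 = 0 := by
  rw [background, shear_lift]
  simp

include hsep in
theorem flow_lift_one (i : VortexIndex n N) (θ : Torus N) {x : Space (n + 2)}
    (hx : proj x 1 = h i) :
    (flow h hε hε' ν θ).lift x 1 =
      -(angularVelocity ε (residue (proj x (axis i) - centre h θ i (axis i)) ^ 2) *
        residue (proj x (axis i) - centre h θ i (axis i))) := by
  rw [flow_lift_of_strip hε hε' ν hsep i θ (by rw [hx, sub_self, norm_zero]; exact hε.le),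
    PiLp.add_apply, background_lift_one, vortexField, centre_apply_one, hx, sub_self, residue_zero]
  simp

include hsep in
-- On the edge of a strip every vortex vanishes, leaving only the shear.
theorem flow_lift_one_eq_zero (i : VortexIndex n N) (θ : Torus N) {x : Space (n + 2)}
    (hx : ‖proj x 1 - h i‖ = ε) : (flow h hε hε' ν θ).lift x 1 = 0 := by
  rw [flow_lift_of_strip hε hε' ν hsep i θ hx.le, PiLp.add_apply, background_lift_one,
    vortexField_eq_zero]
  · simp
  · rw [centre_apply_one, hx]
    nlinarith [sq_nonneg ‖proj x (axis i) - centre h θ i (axis i)‖]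

include hsep in
theorem isNonSymmetric_flow : IsNonSymmetric (flow h hε hε' ν) := by
  intro θ a ha hinv
  have hshift : ∀ (s : ℝ) (x : Space (n + 2)),
      (flow h hε hε' ν θ).lift (x + s • a) = (flow h hε hε' ν θ).lift x := by
    intro s x
    rw [SVect.lift, SVect.lift, proj_add]
    exact hinv s (proj x)
  have hhalf : |ε / 2| < Real.pi := by rw [abs_of_pos (half_pos hε)]; linarith
  -- a point of the strip of the `k`-th fixed vortex where the coordinate `1` is nonzero
  have hpoint : ∀ k : {k : Fin (n + 2) // k ≠ 1}, ∃ x : Space (n + 2), proj x 1 = h (.inr k) ∧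
      x k = ε / 2 ∧ (flow h hε hε' ν θ).lift x 1 ≠ 0 := by
    intro k
    obtain ⟨y, hy, -⟩ := exists_proj_eq (Pi.single 1 (h (.inr k)) : Torus (n + 2))
    set x : Space (n + 2) := y + (ε / 2 - y k) • EuclideanSpace.single k.1 (1 : ℝ) with hx
    have h1 : proj x 1 = h (.inr k) := by
      rw [hx, proj_add, hy, proj_smul_single]
      simp [k.2.symm]
    have h2 : x k = ε / 2 := by simp [hx]
    refine ⟨x, h1, h2, ?_⟩
    have h3 : proj x k = ((ε / 2 : ℝ) : AddCircle (2 * Real.pi)) := by rw [← h2]; rfl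
    rw [flow_lift_one hε hε' ν hsep (.inr k) θ h1]
    change -(angularVelocity ε (residue (proj x k - centre h θ (.inr k) k) ^ 2) *
      residue (proj x k - centre h θ (.inr k) k)) ≠ 0
    rw [centre_inr_axis, sub_zero, h3, residue_coe hhalf]
    refine neg_ne_zero.2 (mul_ne_zero ?_ (half_pos hε).ne')
    rw [Ne, angularVelocity_eq_zero_iff, not_le]
    nlinarith
  -- A translation that fixes the height slides the chosen point, in the strip of the vortex of a
  -- plane `(k, 1)` with `a k ≠ 0`, to coordinate `k` equal to `0`, the centre of that vortex. One
  -- that changes the height takes a point of some fixed vortex to the edge of its strip. Either way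
  -- the component along `e₁` goes from nonzero to zero.
  by_cases ha1 : a 1 = 0
  · obtain ⟨k, hk⟩ : ∃ k, a k ≠ 0 := by
      by_contra! hcon
      exact ha (by ext k; simpa using hcon k)
    let κ : {k : Fin (n + 2) // k ≠ 1} := ⟨k, fun e => hk (e ▸ ha1)⟩
    obtain ⟨x, hx1, hxk, hx⟩ := hpoint κ
    apply hx
    set s := -(ε / 2) / a k with hs
    have e1 : proj (x + s • a) 1 = h (.inr κ) := by
      rw [← hx1]; simp [proj, ha1]
    have e2 : proj (x + s • a) k = 0 := by
      have : (x + s • a) k = 0 := by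
        rw [PiLp.add_apply, PiLp.smul_apply, hxk, hs, smul_eq_mul, div_mul_cancel₀ _ hk]
        ring
      change (((x + s • a) k : ℝ) : AddCircle (2 * Real.pi)) = 0
      rw [this, AddCircle.coe_zero]
    rw [← hshift s x, flow_lift_one hε hε' ν hsep _ θ e1]
    change -(angularVelocity ε (residue (proj (x + s • a) k - centre h θ (.inr κ) κ) ^ 2) *
      residue (proj (x + s • a) k - centre h θ (.inr κ) κ)) = 0
    rw [centre_inr_axis, e2, sub_zero, residue_zero, mul_zero, neg_zero]
  · obtain ⟨x, hx1, -, hx⟩ := hpoint ⟨0, zero_ne_one⟩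
    apply hx
    rw [← hshift (ε / a 1) x]
    apply flow_lift_one_eq_zero hε hε' ν hsep (.inr ⟨0, zero_ne_one⟩)
    have : proj (x + (ε / a 1) • a) 1 = proj x 1 + ((ε : ℝ) : AddCircle (2 * Real.pi)) := by
      change (((x + (ε / a 1) • a) 1 : ℝ) : AddCircle (2 * Real.pi)) = _
      rw [PiLp.add_apply, PiLp.smul_apply, smul_eq_mul, div_mul_cancel₀ _ ha1, AddCircle.coe_add]
      rfl
    rw [this, hx1, add_sub_cancel_left, ← abs_residue, residue_coe, abs_of_pos hε]
    rw [abs_of_pos hε]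
    linarith

include hsep in
theorem injective_flow : Function.Injective (flow h hε hε' ν) := by
  intro θ θ' heq
  ext1 j
  have hhalf : |ε / 2| < Real.pi := by rw [abs_of_pos (half_pos hε)]; linarith
  -- The point lies straight above the `j`-th centre. The offset `ε / 2` is needed because at the
  -- height of the centre the vortex has no component along `e₀`. There this component is strictly
  -- largest when the vortex is centred at `θ j`.
  obtain ⟨x, hx, -⟩ := exists_proj_eq (Pi.single 0 (θ j) +
    Pi.single 1 (h (.inl j) + ((ε / 2 : ℝ) : AddCircle (2 * Real.pi))) : Torus (n + 2))
  have hx0 : proj x 0 = θ j := by rw [hx]; simp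
  have hx1 : proj x 1 - h (.inl j) = ((ε / 2 : ℝ) : AddCircle (2 * Real.pi)) := by rw [hx]; simp
  have hnear : ‖proj x 1 - h (.inl j)‖ ≤ ε := by
    rw [hx1, ← abs_residue, residue_coe hhalf, abs_of_pos (half_pos hε)]
    linarith
  have hval : ∀ θ : Torus N, (flow h hε hε' ν θ).lift x 0 = (background h hε hε' ν).lift x 0 +
      angularVelocity ε (residue (proj x 0 - θ j) ^ 2 + (ε / 2) ^ 2) * (ε / 2) := by
    intro θ
    rw [flow_lift_of_strip hε hε' ν hsep (.inl j) θ hnear, PiLp.add_apply, vortexField,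
      centre_apply_one, hx1, residue_coe hhalf]
    simp [axis, centre_inl_zero]
  have h1 := congrArg (fun u : SVect (n + 2) => u.lift x 0) heq
  simp only [hval, hx0, sub_self, residue_zero] at h1
  have h2 := mul_right_cancel₀ (half_pos hε).ne' (add_left_cancel h1)
  by_contra hne
  have h3 : 0 < residue (θ j - θ' j) ^ 2 := by
    have : residue (θ j - θ' j) ≠ 0 := fun e => hne (sub_eq_zero.1 (residue_eq_zero.1 e))
    positivity
  refine (angularVelocity_lt (ε := ε) ?_ ?_).ne' h2
  · nlinarith
  · linarith

include hsep in
theorem isSmoothEmbedding_flow : IsSmoothEmbedding (flow h hε hε' ν) where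
  smooth k := by
    rw [flow_eq_translationFamily]
    exact isCk_translationFamily 0 k _ _
  immersion x v hv := by
    rw [flow_eq_translationFamily]
    refine ⟨_, ?_, hasDirDeriv_translationFamily 0 _ _ x v⟩
    obtain ⟨j, hj⟩ : ∃ j, v j ≠ 0 := by
      by_contra! hcon
      exact hv (by ext j; simpa using hcon j)
    intro hzero
    -- At the centre of the `j`-th vortex its derivative is the angular velocity at `0` times an
    -- infinitesimal rotation, so moving it along `e₀` changes the component along `e₁`; the other
    -- vortices vanish nearby.
    obtain ⟨y, hy, -⟩ := exists_proj_eq (centre h (proj x) (.inl j))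
    have hstrip : ‖proj y 1 - h (.inl j)‖ ≤ ε := by
      rw [hy, centre_apply_one, sub_self, norm_zero]; exact hε.le
    have hterm : ∀ i : Fin N, (SVect.translate (Pi.single 0 (-proj x i))
        (SVect.dirDeriv (-v i • EuclideanSpace.single 0 (1 : ℝ))
          (vortex (axis_ne_one (.inl i)) hε (lt_pi hε hε') (centre h 0 (.inl i))))).lift y =
        fderiv ℝ (vortex (axis_ne_one (.inl i)) hε (lt_pi hε hε')
          (centre h (proj x) (.inl i))).lift y (-v i • EuclideanSpace.single 0 (1 : ℝ)) := by
      intro i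
      have e : centre h (proj x) (.inl i) =
          centre h 0 (.inl i) - proj (-x i • EuclideanSpace.single 0 (1 : ℝ)) := by
        rw [← single_neg_eq_proj, centre_eq_sub]
        rfl
      rw [e, ← vortex_translate, SVect.lift_translate_proj, fderiv_comp_add_right]
      change (SVect.translate (Pi.single 0 (-(x i : AddCircle (2 * Real.pi)))) _).lift y = _
      rw [single_neg_eq_proj, SVect.lift_translate_proj, SVect.lift_dirDeriv]
    have h1 := congrArg (fun u : SVect (n + 2) => u.lift y 1) hzero
    simp only [translationFamily, zero_add, SVect.lift_sum, Finset.sum_apply, hterm] at h1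
    rw [Finset.sum_eq_single j] at h1
    · obtain ⟨z, hz0, hz1, hz⟩ := fderiv_vortex_lift (axis_ne_one (.inl j)) hε (lt_pi hε hε')
        (centre h (proj x) (.inl j)) y
      rw [hy, sub_self, residue_zero] at hz0 hz1
      rw [hz, fderiv_circularFlow, hz0, hz1] at h1
      simp [axis, SVect.lift_zero, hj, angularVelocity_eq_zero_iff, hε.ne'] at h1
    · intro i _ hij
      rw [(vortex_lift_eq_zero_of_ne hε hε' hsep (i := .inl j) (by simpa using hij)
        (proj x) hstrip).2]
      simp
    · simp
  isEmbedding := by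
    refine (Continuous.isClosedEmbedding ?_ (injective_flow hε hε' ν hsep)).isEmbedding
    rw [flow_eq_translationFamily]
    exact continuous_translationFamily _ _ _

include hsep in
theorem isTheEulerSolution_flow (θ : Torus N) :
    IsTheEulerSolution (flow h hε hε' ν θ)
      (fun t : ℝ => flow h hε hε' ν (θ + proj (t • ν))) := by
  obtain ⟨θ, rfl, -⟩ := exists_proj_eq θ
  set μ : VortexIndex n N → ℝ := Sum.elim ν fun _ => 0 with hμ
  set g : VortexIndex n N → ℝ := Sum.elim θ fun _ => 0 with hg
  set V : VortexIndex n N → SVect (n + 2) := fun i =>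
    vortex (axis_ne_one i) hε (lt_pi hε hε') (centre h 0 i) with hV
  set e : Space (n + 2) := EuclideanSpace.single 0 (1 : ℝ) with he
  -- In the lift, vortex `i` is displaced by `(g i + t μ i) e₀`, which is affine in time. Fixed
  -- vortices have `g i = μ i = 0`.
  have hcentre : ∀ (t : ℝ) (i : VortexIndex n N), centre h (proj θ + proj (t • ν)) i =
      centre h 0 i - proj (-((g i + t * μ i) • e)) := by
    intro t i
    rw [centre_eq_sub, ← neg_smul, proj_smul_single, AddCircle.coe_neg]
    rcases i with j | k
    · rfl
    · simp [hg, hμ]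
  have hVt : ∀ (t : ℝ) (i : VortexIndex n N) (x : Space (n + 2)),
      (vortex (axis_ne_one i) hε (lt_pi hε hε') (centre h (proj θ + proj (t • ν)) i)).lift x =
        (V i).lift (x - (g i + t * μ i) • e) := by
    intro t i x
    rw [hcentre, ← vortex_translate, SVect.lift_translate_proj, sub_eq_add_neg]
  have hlift : ∀ (t : ℝ) (x : Space (n + 2)), (flow h hε hε' ν (proj θ + proj (t • ν))).lift x =
      (background h hε hε' ν).lift x + ∑ i, (V i).lift (x - (g i + t * μ i) • e) := by
    intro t x
    rw [flow, SVect.lift_add, SVect.lift_sum, Pi.add_apply, Finset.sum_apply]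
    simp only [hVt]
  have hpt : ∀ (t : ℝ) (i : VortexIndex n N) (x : Space (n + 2)),
      vortexPressure (axis i) 1 ε (centre h (proj θ + proj (t • ν)) i) (proj x) =
        vortexPressure (axis i) 1 ε (centre h 0 i) (proj (x - (g i + t * μ i) • e)) := by
    intro t i x
    rw [hcentre, sub_eq_add_neg x, proj_add]
    simp only [vortexPressure, Pi.sub_apply, Pi.add_apply]
    congr 4 <;> abel
  have hshift : ∀ i : VortexIndex n N, ContDiff ℝ ∞ fun z : ℝ × Space (n + 2) =>
      z.2 - (g i + z.1 * μ i) • e := fun i =>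
    contDiff_snd.sub ((contDiff_const.add (contDiff_fst.mul contDiff_const)).smul contDiff_const)
  have hsol : IsEulerSolutionOn Set.univ
      (fun t : ℝ => flow h hε hε' ν (proj θ + proj (t • ν))) := by
    refine ⟨ContDiff.contDiffOn ?_, fun t X => ∑ i, vortexPressure (axis i) 1 ε
      (centre h (proj θ + proj (t • ν)) i) X, ContDiff.contDiffOn ?_, fun t _ x => ?_⟩
    · simp only [hlift]
      exact ((background h hε hε' ν).contDiff_lift.comp contDiff_snd).add
        (ContDiff.sum fun i _ => (V i).contDiff_lift.comp (hshift i))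
    · simp only [hpt]
      exact ContDiff.sum fun i _ => (contDiff_vortexPressure (axis_ne_one i) hε
        (lt_pi hε hε') (centre h 0 i)).comp (hshift i)
    · have hterm : ∀ i, HasDerivAt (fun s : ℝ => (V i).lift (x - (g i + s * μ i) • e))
          (-(μ i • fderiv ℝ (vortex (axis_ne_one i) hε (lt_pi hε hε')
            (centre h (proj θ + proj (t • ν)) i)).lift x e)) t := by
        intro i
        have h1 : HasDerivAt (fun s : ℝ => x - (g i + s * μ i) • e) (-(μ i • e)) t := by
          have := ((((hasDerivAt_id t).mul_const (μ i)).const_add (g i)).smul_const e).const_sub x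
          simpa using this
        have h2 := ((V i).differentiable_lift _).hasFDerivAt.comp_hasDerivAt t h1
        refine h2.congr_deriv ?_
        rw [funext (hVt t i), fderiv_comp_sub, map_neg, map_smul]
      have hder := (HasDerivAt.fun_sum fun i (_ : i ∈ Finset.univ) => hterm i).const_add
        ((background h hε hε' ν).lift x)
      -- The nonlinearity and the pressure gradient add up to `∑ μ i ∂₀(vortex i)`, exactly opposite
      -- to the time derivative.
      have key := fderiv_shear_add_vortices (zero_ne_one : (0 : Fin (n + 2)) ≠ 1) hε
        (lt_pi hε hε') axis_ne_one (centre h (proj θ + proj (t • ν)))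
        (fun i j hij => by
          rw [centre_apply_one, centre_apply_one]
          linarith [hsep i j hij])
        (contDiff_velocityProfile h hε hε' ν) (μ := μ)
        (fun i Y hY => velocityProfile_eq hε ν hsep i (by rwa [centre_apply_one] at hY)) x
      rw [derivWithin_univ, add_assoc, funext fun s => hlift s x, hder.deriv,
        Finset.sum_neg_distrib, neg_add_eq_zero]
      exact key.symm
  refine ⟨?_, hsol, fun I hI h0 w hw hw0 t ht => euler_unique hI h0 hsol hw ?_ ht⟩
  · simp [show proj (0 : Space N) = 0 from rfl]
  · rw [hw0]
    simp [show proj (0 : Space N) = 0 from rfl]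

end Construction

end EulerTorus

end

theorem theorem1p1 (d : ℕ) (hd : d = 3 ∨ (0 < d ∧ Even d)) (N : ℕ) (hN : 1 ≤ N)
    (ν : EulerTorus.Space N) (hν : ν ≠ 0) :
    ∃ U : EulerTorus.Torus N → EulerTorus.SVect d,
      EulerTorus.IsSmoothEmbedding U ∧ EulerTorus.IsNonSymmetric U ∧
      ∀ θ : EulerTorus.Torus N,
        EulerTorus.IsTheEulerSolution (U θ) (fun t : ℝ => U (θ + EulerTorus.proj (t • ν))) := by
  -- Both cases give `2 ≤ d`: one coordinate along the shear and one across it.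
  obtain ⟨n, rfl⟩ : ∃ n, d = n + 2 := by
    refine ⟨d - 2, ?_⟩
    rcases hd with rfl | ⟨hd, k, rfl⟩ <;> omega
  obtain ⟨ε, hε, hε', h, hsep⟩ :=
    EulerTorus.exists_separated_heights (EulerTorus.VortexIndex n N)
  exact ⟨EulerTorus.flow h hε hε' ν, EulerTorus.isSmoothEmbedding_flow hε hε' ν hsep,
    EulerTorus.isNonSymmetric_flow hε hε' ν hsep,
    EulerTorus.isTheEulerSolution_flow hε hε' ν hsep⟩
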